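/- Let $M$ be a smooth 3-manifold with a projective structure $p$, i.e. an equivalence class of smooth torsion-free affine connections on $TM$, where $\nabla\sim\widehat\nabla$ if and only if there is a smooth 1-form $\Upsilon$ with $\widehat\nabla_X Y=\nabla_X Y+\Upsilon(X)\,Y+\Upsilon(Y)\,X$ for all vector fields $X,Y$. For a torsion-free connection $\nabla$ on an $n$-manifold ($n\ge 2$), with curvature $(\nabla_a\nabla_b-\nabla_b\nabla_a)v^c=R_{ab}{}^c{}_d v^d$ and Ricci tensor $\mathrm{Ric}_{ab}=R_{ca}{}^c{}_b$, the projective Weyl tensor $W$ is defined by $$R_{ab}{}^c{}_d=W_{ab}{}^c{}_d+\delta^c_a P_{bd}-\delta^c_b P_{ad}+\beta_{ab}\delta^c_d,\qquad \beta_{ab}=P_{ba}-P_{ab},\qquad (n-1)P_{ab}=\mathrm{Ric}_{ab}+\beta_{ab}.$$ An Einstein metric is a pseudo-Riemannian metric $g$ (of any signature) with $\mathrm{Ric}=c\,g$ for a constant $c$. Let $\nabla\in p$ be any connection in the class. Then the projective Weyl tensor of $\nabla$ sharply obstructs the existence of an Einstein Levi-Civita connection in $p$: 1. If $p$ contains the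 Levi-Civita connection of an Einstein metric on $M$, then $W=0$. 2. $W=0$ on $M$ if and only if every point of $M$ has an open neighbourhood $U$ such that the restriction of $p$ to $U$ contains the Levi-Civita connection of an Einstein metric on $U$. -/

import Mathlib

open Set Bundle
open scoped Manifold ContDiff

noncomputable section

/-!
Projective structures, projective Weyl curvature and Einstein Levi-Civita connections on smooth
manifolds `M` modelled on `ℝⁿ`.

Objects living on an open subset `U` of `M` are represented by total functions on `M` which are
only constrained, and only used, at the points of `U`.
-/

namespace ProjGeom

/-- Vector fields on `M` (no regularity imposed). -/
abbrev VField (n : ℕ) (M : Type*) [TopologicalSpace M]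
    [ChartedSpace (EuclideanSpace ℝ (Fin n)) M] :=
  Π x : M, TangentSpace (𝓡 n) x

/-- The operator `Y ↦ ∇Y` underlying an affine connection, in Mathlib's argument order:
`D Y x v` is `(∇_v Y)(x)`. -/
abbrev ConnOp (n : ℕ) (M : Type*) [TopologicalSpace M]
    [ChartedSpace (EuclideanSpace ℝ (Fin n)) M] :=
  VField n M → Π x : M, TangentSpace (𝓡 n) x →L[ℝ] TangentSpace (𝓡 n) x

/-- Fields of bilinear forms on the tangent spaces. -/
abbrev BilinField (n : ℕ) (M : Type*) [TopologicalSpace M]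
    [ChartedSpace (EuclideanSpace ℝ (Fin n)) M] :=
  Π x : M, TangentSpace (𝓡 n) x →L[ℝ] TangentSpace (𝓡 n) x →L[ℝ] ℝ

/-- Fields of linear forms on the tangent spaces. -/
abbrev CovectorField (n : ℕ) (M : Type*) [TopologicalSpace M]
    [ChartedSpace (EuclideanSpace ℝ (Fin n)) M] :=
  Π x : M, TangentSpace (𝓡 n) x →L[ℝ] ℝ

section

variable {n : ℕ} {M : Type*} [TopologicalSpace M] [ChartedSpace (EuclideanSpace ℝ (Fin n)) M]

/-- The vector field `Y` is differentiable at `x`. -/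
def DiffAt [IsManifold (𝓡 n) ∞ M] (Y : VField n M) (x : M) : Prop :=
  MDifferentiableAt (𝓡 n) ((𝓡 n).prod 𝓘(ℝ, EuclideanSpace ℝ (Fin n)))
    (fun y ↦ TotalSpace.mk' (EuclideanSpace ℝ (Fin n)) y (Y y)) x

/-- `D` is a smooth torsion-free affine connection on the open set `U`. -/
structure IsTorsionFreeConnectionOn [IsManifold (𝓡 n) ∞ M] (D : ConnOp n M) (U : Set M) :
    Prop where
  isCovariantDerivative : IsCovariantDerivativeOn (EuclideanSpace ℝ (Fin n)) D U
  smooth : ContMDiffCovariantDerivativeOn (EuclideanSpace ℝ (Fin n)) ∞ D U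
  torsionFree : ∀ x ∈ U, ∀ X Y : VField n M, DiffAt X x → DiffAt Y x →
    D Y x (X x) - D X x (Y x) = VectorField.mlieBracket (𝓡 n) X Y x

/-- The 1-form `Υ` is smooth on `U`. -/
def SmoothCovectorOn [IsManifold (𝓡 n) ∞ M] (Υ : CovectorField n M) (U : Set M) : Prop :=
  ContMDiffOn (𝓡 n) ((𝓡 n).prod 𝓘(ℝ, EuclideanSpace ℝ (Fin n) →L[ℝ] ℝ)) ∞
    (fun x ↦ TotalSpace.mk' (EuclideanSpace ℝ (Fin n) →L[ℝ] ℝ)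
      (E := fun x : M ↦ TangentSpace (𝓡 n) x →L[ℝ] Trivial M ℝ x) x (Υ x)) U

/-- The connections `D` and `D'` on `U` are projectively equivalent there:
`∇'_v Y = ∇_v Y + Υ(v) Y + Υ(Y) v` on `U` for some smooth 1-form `Υ` on `U`. -/
def ProjectivelyEquivOn [IsManifold (𝓡 n) ∞ M] (D D' : ConnOp n M) (U : Set M) : Prop :=
  ∃ Υ : CovectorField n M, SmoothCovectorOn Υ U ∧
    ∀ x ∈ U, ∀ Y : VField n M, DiffAt Y x → ∀ v : TangentSpace (𝓡 n) x,
      D' Y x v = D Y x v + Υ x v • Y x + Υ x (Y x) • v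

variable (n M) in
/-- A projective structure on `M`: an equivalence class, for projective equivalence, of smooth
torsion-free affine connections on `M`. -/
structure ProjectiveStructure [IsManifold (𝓡 n) ∞ M] where
  connections : Set (ConnOp n M)
  nonempty : connections.Nonempty
  isConnection : ∀ D ∈ connections, IsTorsionFreeConnectionOn D univ
  isClass : ∀ D ∈ connections, ∀ D' : ConnOp n M, IsTorsionFreeConnectionOn D' univ →
    (D' ∈ connections ↔ ProjectivelyEquivOn D D' univ)

/-- The curvature operator on vector fields,
`R(X, Y) Z = ∇_X ∇_Y Z - ∇_Y ∇_X Z - ∇_[X,Y] Z`. -/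
def curvatureOp (D : ConnOp n M) (X Y Z : VField n M) (x : M) : TangentSpace (𝓡 n) x :=
  D (fun y ↦ D Z y (Y y)) x (X x) - D (fun y ↦ D Z y (X y)) x (Y x)
    - D Z x (VectorField.mlieBracket (𝓡 n) X Y x)

/-- The curvature tensor `R_{ab}{}^c{}_d u^a v^b w^d` at `x`, computed with Mathlib's extensions of
tangent vectors at `x` to vector fields that are smooth near `x`. -/
def curvature [IsManifold (𝓡 n) ∞ M] (D : ConnOp n M) (x : M) (u v w : TangentSpace (𝓡 n) x) :
    TangentSpace (𝓡 n) x :=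
  curvatureOp D (FiberBundle.extend (EuclideanSpace ℝ (Fin n)) u)
    (FiberBundle.extend (EuclideanSpace ℝ (Fin n)) v)
    (FiberBundle.extend (EuclideanSpace ℝ (Fin n)) w) x

/-- The `i`-th standard basis vector of the tangent space at `x`. -/
def stdVec (x : M) (i : Fin n) : TangentSpace (𝓡 n) x :=
  (EuclideanSpace.single i (1 : ℝ) : EuclideanSpace ℝ (Fin n))

/-- The `i`-th standard coordinate of a tangent vector at `x`. -/
def stdCoord {x : M} (v : TangentSpace (𝓡 n) x) (i : Fin n) : ℝ :=
  (show EuclideanSpace ℝ (Fin n) from v) i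

/-- The Ricci tensor `Ric_{ab} = R_{ca}{}^c{}_b`: `Ric(u, v)` is the trace of
`w ↦ R(w, u) v`. -/
def ricci [IsManifold (𝓡 n) ∞ M] (D : ConnOp n M) (x : M) (u v : TangentSpace (𝓡 n) x) : ℝ :=
  ∑ i : Fin n, stdCoord (curvature D x (stdVec x i) u v) i

/-- The projective Schouten tensor `P_{ab} = (n Ric_{ab} + Ric_{ba}) / (n² - 1)`, i.e. the solution
of `(n - 1) P_{ab} = Ric_{ab} + β_{ab}` with `β_{ab} = P_{ba} - P_{ab}` (for `n ≥ 2`). -/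
def schouten [IsManifold (𝓡 n) ∞ M] (D : ConnOp n M) (x : M) (u v : TangentSpace (𝓡 n) x) : ℝ :=
  ((n : ℝ) * ricci D x u v + ricci D x v u) / ((n : ℝ) ^ 2 - 1)

/-- `β_{ab} = -2 P_{[ab]} = P_{ba} - P_{ab}`. -/
def beta [IsManifold (𝓡 n) ∞ M] (D : ConnOp n M) (x : M) (u v : TangentSpace (𝓡 n) x) : ℝ :=
  schouten D x v u - schouten D x u v

/-- The relation `(n - 1) P = Ric + β` between Schouten and Ricci tensors. -/
theorem schouten_spec [IsManifold (𝓡 n) ∞ M] (hn : 2 ≤ n) (D : ConnOp n M) (x : M)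
    (u v : TangentSpace (𝓡 n) x) :
    ((n : ℝ) - 1) * schouten D x u v = ricci D x u v + beta D x u v := by
  have h : (2 : ℝ) ≤ n := by exact_mod_cast hn
  have h' : (n : ℝ) ^ 2 - 1 ≠ 0 := by nlinarith
  simp only [beta, schouten]
  field_simp
  ring

/-- The projective Weyl tensor, from
`R_{ab}{}^c{}_d = W_{ab}{}^c{}_d + δ^c_a P_{bd} - δ^c_b P_{ad} + β_{ab} δ^c_d`. -/
def weyl [IsManifold (𝓡 n) ∞ M] (D : ConnOp n M) (x : M) (u v w : TangentSpace (𝓡 n) x) :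
    TangentSpace (𝓡 n) x :=
  curvature D x u v w - (schouten D x v w • u - schouten D x u w • v) - beta D x u v • w

/-- `g` is a smooth pseudo-Riemannian metric (of arbitrary signature) on the open set `U`. -/
structure IsMetricOn [IsManifold (𝓡 n) ∞ M] (g : BilinField n M) (U : Set M) : Prop where
  smooth : ContMDiffOn (𝓡 n)
    ((𝓡 n).prod 𝓘(ℝ, EuclideanSpace ℝ (Fin n) →L[ℝ] EuclideanSpace ℝ (Fin n) →L[ℝ] ℝ)) ∞
    (fun x ↦ TotalSpace.mk' (EuclideanSpace ℝ (Fin n) →L[ℝ] EuclideanSpace ℝ (Fin n) →L[ℝ] ℝ)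
      (E := fun x : M ↦ TangentSpace (𝓡 n) x →L[ℝ] TangentSpace (𝓡 n) x →L[ℝ] Trivial M ℝ x)
      x (g x)) U
  symm : ∀ x ∈ U, ∀ v w, g x v w = g x w v
  nondegenerate : ∀ x ∈ U, ∀ v, (∀ w, g x v w = 0) → v = 0

/-- `D` is the Levi-Civita connection of `g` on the open set `U`: it is torsion-free and
`v(g(Y, Z)) = g(∇_v Y, Z) + g(Y, ∇_v Z)`. -/
def IsLeviCivitaOn [IsManifold (𝓡 n) ∞ M] (D : ConnOp n M) (g : BilinField n M) (U : Set M) :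
    Prop :=
  IsTorsionFreeConnectionOn D U ∧
    ∀ x ∈ U, ∀ Y Z : VField n M, DiffAt Y x → DiffAt Z x → ∀ v : TangentSpace (𝓡 n) x,
      mvfderiv (𝓡 n) (fun y ↦ g y (Y y) (Z y)) x v = g x (D Y x v) (Z x) + g x (Y x) (D Z x v)

/-- On the open set `U` there is an Einstein metric `g`, that is a pseudo-Riemannian metric with
`Ric = c g` for some constant `c`, whose Levi-Civita connection belongs to the restriction to `U`
of the projective class `p`. -/
def ProjectiveStructure.HasEinsteinOn [IsManifold (𝓡 n) ∞ M] (p : ProjectiveStructure n M)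
    (U : Set M) : Prop :=
  ∃ (g : BilinField n M) (D' : ConnOp n M),
    IsMetricOn g U ∧ IsLeviCivitaOn D' g U ∧
    (∃ c : ℝ, ∀ x ∈ U, ∀ u v, ricci D' x u v = c * g x u v) ∧
    ∀ D ∈ p.connections, ProjectivelyEquivOn D D' U

/-- The projective Weyl tensor of the connection `D` vanishes identically on `M`. -/
def WeylVanishes [IsManifold (𝓡 n) ∞ M] (D : ConnOp n M) : Prop :=
  ∀ (x : M) (u v w : TangentSpace (𝓡 n) x), weyl D x u v w = 0

end

end ProjGeom

end

/-!
The projective Weyl tensor is a projective invariant: a change by the 1-form `Υ` changes the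
Schouten tensor by `-(∇Υ - Υ ⊗ Υ)`, and this is exactly compensated by the change of the curvature
(`weylOf_riem_add_projTerm`). In dimension three the curvature of a metric is determined by its
Ricci tensor, so that an Einstein metric has constant curvature
`R(u, v) w = (c / 2) (g(v, w) u - g(u, w) v)`; its Schouten tensor is `(c / 2) g`, and its projective Weyl tensor vanishes
(`weylOf_eq_zero_of_einstein`). Together these facts show that the projective Weyl tensor of every
connection in the class vanishes wherever the class contains the Levi-Civita connection of an
Einstein metric (`weyl_eq_zero_of_hasEinsteinOn`).

Conversely, let the projective Weyl tensor vanish. In a chart, a projective change makes the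
Christoffel symbols `Γ` trace-free. Then the Schouten tensor `P` is symmetric and the curvature is
`R(u, v) w = P(v, w) u - P(u, w) v`. In dimension at least three the contracted second Bianchi
identity shows that `∇P` is totally symmetric (`cotton_eq_zero`), so that the tractor system
`∇σ = μ`, `∇μ = -P ⊗ σ` is integrable and has local solutions with arbitrary initial values
(`exists_parallel_tractor`), by a Frobenius theorem for linear systems which is proved here by
Picard iteration along rays (`exists_hasFDerivAt_of_integrable`). Quotients of solutions are
affine coordinates: their differentials form a coframe that is parallel for a connection in the
class (`exists_parallel_coframe`). That connection is therefore flat, and it is the Levi-Civita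
connection of the metric for which the coframe is orthonormal, which is Einstein with constant `0`
(`exists_hasEinsteinOn_of_weylVanishes`).

Both arguments are made for Christoffel symbols on open subsets of a vector space. They are
transferred to the manifold by expressing an abstract connection in a chart as `d + Γ`
(`toCoord_covariantDerivative`), which gives its curvature, Ricci and projective Weyl tensors in
terms of `Γ` (`toCoord_curvature`, `ricci_eq_ricOf`, `toCoord_weyl`).
-/

open Set Bundle Filter Topology Interval Module
open scoped Manifold ContDiff

-- Instances on iterated spaces of continuous linear maps need a deeper instance search.
set_option maxSynthPendingDepth 3

noncomputable section

namespace ProjGeom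

/-! ### Linear integrable systems -/

section Frobenius

variable {E F : Type*} [NormedAddCommGroup E] [NormedSpace ℝ E] [NormedAddCommGroup F]
  [NormedSpace ℝ F]

theorem hasFDerivAt_slice {g : E → ℝ → F} (hg : ContDiff ℝ 1 (Function.uncurry g))
    (y : E) (t : ℝ) : HasFDerivAt (fun y ↦ g y t)
      ((fderiv ℝ (Function.uncurry g) (y, t)).comp (ContinuousLinearMap.inl ℝ E ℝ)) y :=
  HasFDerivAt.comp (g := Function.uncurry g) (f := fun e : E ↦ (e, t)) y
    (hg.differentiable (by simp) (y, t)).hasFDerivAt (hasFDerivAt_prodMk_left (𝕜 := ℝ) y t)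

theorem hasFDerivAt_integral_of_contDiff [FiniteDimensional ℝ E] {g : E → ℝ → F}
    (hg : ContDiff ℝ 1 (Function.uncurry g)) (z : E) :
    HasFDerivAt (fun z ↦ ∫ t in (0 : ℝ)..1, g z t)
      (∫ t in (0 : ℝ)..1, fderiv ℝ (fun y ↦ g y t) z) z := by
  have hd := hasFDerivAt_slice hg
  have hc : Continuous (fun p : E × ℝ ↦ fderiv ℝ (fun y ↦ g y p.2) p.1) := by
    have : (fun p : E × ℝ ↦ fderiv ℝ (fun y ↦ g y p.2) p.1) = fun p ↦
        (fderiv ℝ (Function.uncurry g) p).comp (ContinuousLinearMap.inl ℝ E ℝ) := by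
      ext1 p
      exact (hd p.1 p.2).fderiv
    rw [this]
    exact (hg.continuous_fderiv (by simp)).clm_comp continuous_const
  obtain ⟨C, hC⟩ := ((isCompact_closedBall z (1 : ℝ)).prod
    (isCompact_Icc (a := (0 : ℝ)) (b := 1))).exists_bound_of_continuousOn hc.continuousOn
  refine intervalIntegral.hasFDerivAt_integral_of_dominated_of_fderiv_le
    (F' := fun y t ↦ fderiv ℝ (fun y ↦ g y t) y) (bound := fun _ ↦ C)
    (Metric.closedBall_mem_nhds z one_pos) ?_ ?_ ?_ ?_ ?_ ?_
  · exact Eventually.of_forall fun y ↦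
      (hg.continuous.comp (by fun_prop : Continuous fun t : ℝ ↦ (y, t))).aestronglyMeasurable
  · exact (hg.continuous.comp
      (by fun_prop : Continuous fun t : ℝ ↦ (z, t))).intervalIntegrable _ _
  · exact (hc.comp (by fun_prop : Continuous fun t : ℝ ↦ (z, t))).aestronglyMeasurable
  · refine Eventually.of_forall fun t ht y hy ↦ hC (y, t) ⟨hy, ?_⟩
    rw [uIoc_of_le zero_le_one] at ht
    exact Ioc_subset_Icc_self ht
  · simp
  · refine Eventually.of_forall fun t _ y _ ↦ ?_
    exact (hd y t).differentiableAt.hasFDerivAt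

theorem contDiff_one_integral [FiniteDimensional ℝ E] {g : E → ℝ → F}
    (hg : ContDiff ℝ 1 (Function.uncurry g)) :
    ContDiff ℝ 1 (fun z ↦ ∫ t in (0 : ℝ)..1, g z t) := by
  rw [contDiff_one_iff_hasFDerivAt]
  refine ⟨_, ?_, fun z ↦ hasFDerivAt_integral_of_contDiff hg z⟩
  apply intervalIntegral.continuous_parametric_intervalIntegral_of_continuous'
  have hd := hasFDerivAt_slice hg
  have : (Function.uncurry fun (z : E) (t : ℝ) ↦ fderiv ℝ (fun y ↦ g y t) z) = fun p ↦
        (fderiv ℝ (Function.uncurry g) p).comp (ContinuousLinearMap.inl ℝ E ℝ) := by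
    ext1 p
    exact (hd p.1 p.2).fderiv
  rw [this]
  exact (hg.continuous_fderiv (by simp)).clm_comp continuous_const

/-- One Picard step for the system `Df = A f` along rays from the origin. -/
def picardStep (A : E → E →L[ℝ] F →L[ℝ] F) (f₀ : F) (f : E → F) (z : E) : F :=
  f₀ + ∫ t in (0 : ℝ)..1, A (t • z) z (f (t • z))

/-- The failure of `f` to solve `Df = A f`. -/
def defect (A : E → E →L[ℝ] F →L[ℝ] F) (f : E → F) (z : E) : E →L[ℝ] F :=
  fderiv ℝ f z - (A z).flip (f z)

variable {A : E → E →L[ℝ] F →L[ℝ] F} {f₀ : F} {f : E → F}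

theorem contDiff_picardIntegrand (hA : ContDiff ℝ 1 A) (hf : ContDiff ℝ 1 f) :
    ContDiff ℝ 1 (Function.uncurry fun (z : E) (t : ℝ) ↦ A (t • z) z (f (t • z))) := by
  unfold Function.uncurry
  have h1 : ContDiff ℝ 1 fun p : E × ℝ ↦ p.2 • p.1 := contDiff_snd.smul contDiff_fst
  exact ((hA.comp h1).clm_apply contDiff_fst).clm_apply (hf.comp h1)

theorem contDiff_picardStep [FiniteDimensional ℝ E] (hA : ContDiff ℝ 1 A) (hf : ContDiff ℝ 1 f) :
    ContDiff ℝ 1 (picardStep A f₀ f) :=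
  contDiff_const.add (contDiff_one_integral (contDiff_picardIntegrand hA hf))

/-- If the system is integrable, then the derivative of a Picard step is `A z u (f z)` up to an
integral of the defect of `f`. Indeed `A z u (f z)` is the integral over `[0, 1]` of the
derivative of `t ↦ t • A (t • z) u (f (t • z))`, and integrability allows to exchange `u` and `z`
in the derivative of `A`. -/
theorem fderiv_picardStep [FiniteDimensional ℝ E] [CompleteSpace F]
    (hA : ContDiff ℝ 1 A) (hf : ContDiff ℝ 1 f) {r : ℝ}
    (hint : ∀ z ∈ Metric.ball (0 : E) r, ∀ (u v : E) (a : F),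
      fderiv ℝ A z u v a + A z v (A z u a) = fderiv ℝ A z v u a + A z u (A z v a))
    {z : E} (hz : z ∈ Metric.ball (0 : E) r) (u : E) :
    fderiv ℝ (picardStep A f₀ f) z u = A z u (f z) +
      ∫ t in (0 : ℝ)..1, t • (A (t • z) z (defect A f (t • z) u)
        - A (t • z) u (defect A f (t • z) z)) := by
  have hAd := hA.differentiable (by simp)
  have hfd := hf.differentiable (by simp)
  have hAc := hA.continuous_fderiv (by simp)
  have hfc := hf.continuous_fderiv (by simp)
  have h0 := (hasFDerivAt_integral_of_contDiff (contDiff_picardIntegrand hA hf) z).const_add f₀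
  have h1 : ∀ t : ℝ, HasFDerivAt (fun y : E ↦ t • y) (t • ContinuousLinearMap.id ℝ E) z :=
    fun t ↦ (hasFDerivAt_id z).const_smul t
  have h2 : ∀ t : ℝ, fderiv ℝ (fun y ↦ A (t • y) y (f (t • y))) z u =
      t • fderiv ℝ A (t • z) u z (f (t • z)) + A (t • z) u (f (t • z))
        + t • A (t • z) z (fderiv ℝ f (t • z) u) := by
    intro t
    have hA1 := (hAd (t • z)).hasFDerivAt.comp z (h1 t)
    have hf1 := (hfd (t • z)).hasFDerivAt.comp z (h1 t)
    have := ((hA1.clm_apply (hasFDerivAt_id z)).clm_apply hf1).fderiv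
    simp only [Function.comp_def, id] at this
    rw [this]
    simp
    abel
  have h3 : ∀ t : ℝ, HasDerivAt (fun t : ℝ ↦ t • A (t • z) u (f (t • z)))
      (A (t • z) u (f (t • z)) + t • (fderiv ℝ A (t • z) z u (f (t • z))
        + A (t • z) u (fderiv ℝ f (t • z) z))) t := by
    intro t
    have e1 : HasDerivAt (fun t : ℝ ↦ t • z) z t := by
      simpa using (hasDerivAt_id t).smul_const z
    have hA1 := (hAd (t • z)).hasFDerivAt.comp_hasDerivAt t e1
    have hf1 := (hfd (t • z)).hasFDerivAt.comp_hasDerivAt t e1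
    have := (hasDerivAt_id t).smul ((hA1.clm_apply (hasDerivAt_const t u)).clm_apply hf1)
    simp only [Function.comp_def, id] at this
    convert! this using 1
    simp
    abel
  have ht : Continuous fun t : ℝ ↦ t • z := by fun_prop
  have cA : Continuous fun t : ℝ ↦ A (t • z) := hA.continuous.comp ht
  have cf : Continuous fun t : ℝ ↦ f (t • z) := hf.continuous.comp ht
  have cA' : Continuous fun t : ℝ ↦ fderiv ℝ A (t • z) := hAc.comp ht
  have cf' : Continuous fun t : ℝ ↦ fderiv ℝ f (t • z) := hfc.comp ht
  have c1 : Continuous fun t : ℝ ↦ A (t • z) u (f (t • z)) :=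
    (cA.clm_apply continuous_const).clm_apply cf
  have c2 : Continuous fun t : ℝ ↦ t • (fderiv ℝ A (t • z) z u (f (t • z))
        + A (t • z) u (fderiv ℝ f (t • z) z)) :=
    continuous_id.smul ((((cA'.clm_apply continuous_const).clm_apply continuous_const).clm_apply
      cf).add ((cA.clm_apply continuous_const).clm_apply (cf'.clm_apply continuous_const)))
  have h4 : ∫ t in (0 : ℝ)..1, (A (t • z) u (f (t • z)) + t • (fderiv ℝ A (t • z) z u (f (t • z))
        + A (t • z) u (fderiv ℝ f (t • z) z))) = A z u (f z) := by
    rw [intervalIntegral.integral_eq_sub_of_hasDerivAt (fun t _ ↦ h3 t)]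
    · simp
    · exact (c1.add c2).intervalIntegrable _ _
  have h5 : Continuous fun t : ℝ ↦ fderiv ℝ (fun y ↦ A (t • y) y (f (t • y))) z := by
    have hg := contDiff_picardIntegrand hA hf
    have hd := hasFDerivAt_slice hg z
    rw [funext fun t ↦ (hd t).fderiv]
    exact ((hg.continuous_fderiv (by simp)).comp
      (by fun_prop : Continuous fun t : ℝ ↦ (z, t))).clm_comp continuous_const
  have h6 : fderiv ℝ (picardStep A f₀ f) z u =
      ∫ t in (0 : ℝ)..1, fderiv ℝ (fun y ↦ A (t • y) y (f (t • y))) z u := by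
    have : fderiv ℝ (picardStep A f₀ f) z = _ := h0.fderiv
    rw [this, ContinuousLinearMap.intervalIntegral_apply (h5.intervalIntegrable _ _)]
  rw [h6, ← h4, ← intervalIntegral.integral_add]
  · apply intervalIntegral.integral_congr
    intro t htm
    rw [uIcc_of_le zero_le_one] at htm
    have hm : t • z ∈ Metric.ball (0 : E) r := by
      rw [mem_ball_zero_iff] at hz ⊢
      rw [norm_smul, Real.norm_of_nonneg htm.1]
      exact (mul_le_of_le_one_left (norm_nonneg _) htm.2).trans_lt hz
    have hi := hint _ hm u z (f (t • z))
    simp only [h2, defect, sub_apply, ContinuousLinearMap.flip_apply, map_sub]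
    have hi' : fderiv ℝ A (t • z) u z (f (t • z)) = fderiv ℝ A (t • z) z u (f (t • z))
        + A (t • z) u (A (t • z) z (f (t • z))) - A (t • z) z (A (t • z) u (f (t • z))) :=
      eq_sub_of_add_eq hi
    rw [hi']
    module
  · exact (c1.add c2).intervalIntegrable _ _
  · have cd : Continuous fun t : ℝ ↦ defect A f (t • z) := by
      unfold defect
      exact cf'.sub (((ContinuousLinearMap.flipₗᵢ ℝ E F F).continuous.comp cA).clm_apply cf)
    exact (continuous_id.smul (((cA.clm_apply continuous_const).clm_apply
      (cd.clm_apply continuous_const)).sub ((cA.clm_apply continuous_const).clm_apply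
      (cd.clm_apply continuous_const)))).intervalIntegrable _ _

/-- The Frobenius theorem for the linear system `Df = A f` near the origin. Near the origin both the
Picard iterates and their defects converge geometrically, so that the derivatives of the iterates
converge uniformly. -/
theorem exists_hasFDerivAt_of_integrable [FiniteDimensional ℝ E] [CompleteSpace F]
    (hA : ContDiff ℝ 1 A) {r : ℝ} (hr : 0 < r)
    (hint : ∀ z ∈ Metric.ball (0 : E) r, ∀ (u v : E) (a : F),
      fderiv ℝ A z u v a + A z v (A z u a) = fderiv ℝ A z v u a + A z u (A z v a)) (f₀ : F) :
    ∃ ρ > 0, ∃ f : E → F, f 0 = f₀ ∧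
      ∀ z ∈ Metric.ball (0 : E) ρ, HasFDerivAt f ((A z).flip (f z)) z := by
  obtain ⟨C, hC0, hC⟩ : ∃ C > 0, ∀ z ∈ Metric.closedBall (0 : E) 1, ‖A z‖ ≤ C := by
    obtain ⟨C, hC⟩ := (isCompact_closedBall (0 : E) (1 : ℝ)).exists_bound_of_continuousOn
      (f := A) hA.continuous.continuousOn
    exact ⟨max C 1, by positivity, fun z hz ↦ (hC z hz).trans (le_max_left _ _)⟩
  -- On the ball of radius `ρ` a Picard step contracts distances by the factor `1 / 4`.
  obtain ⟨ρ, hρ0, hρr, hρ1, hρC⟩ : ∃ ρ > 0, ρ ≤ r ∧ ρ ≤ 1 ∧ C * ρ ≤ 1 / 4 := by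
    refine ⟨min r (min 1 (1 / 4 / C)), by positivity, min_le_left _ _,
      (min_le_right _ _).trans (min_le_left _ _), ?_⟩
    calc C * min r (min 1 (1 / 4 / C)) ≤ C * (1 / 4 / C) := by
          gcongr
          exact (min_le_right _ _).trans (min_le_right _ _)
      _ = 1 / 4 := by field_simp
  set B := Metric.ball (0 : E) ρ
  have hBr : B ⊆ Metric.ball (0 : E) r := Metric.ball_subset_ball hρr
  have hAB : ∀ z ∈ B, ‖A z‖ ≤ C := fun z hz ↦
    hC z (Metric.ball_subset_closedBall (Metric.ball_subset_ball hρ1 hz))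
  have hray : ∀ z ∈ B, ∀ t ∈ Ι (0 : ℝ) 1, t • z ∈ B := by
    intro z hz t ht
    rw [uIoc_of_le zero_le_one] at ht
    rw [mem_ball_zero_iff] at hz ⊢
    rw [norm_smul, Real.norm_of_nonneg ht.1.le]
    exact (mul_le_of_le_one_left (norm_nonneg _) ht.2).trans_lt hz
  have hsmall : ∀ z ∈ B, ∀ y ∈ B, ‖A y‖ * ‖z‖ ≤ 1 / 4 := by
    intro z hz y hy
    have := mem_ball_zero_iff.1 hz
    calc ‖A y‖ * ‖z‖ ≤ C * ρ := by gcongr; exact hAB y hy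
      _ ≤ _ := hρC
  have hcont : ∀ {g : E → F}, Continuous g → ∀ z, IntervalIntegrable
      (fun t : ℝ ↦ A (t • z) z (g (t • z))) MeasureTheory.volume 0 1 := by
    intro g hg z
    have ht : Continuous fun t : ℝ ↦ t • z := by fun_prop
    have cA : Continuous fun t : ℝ ↦ A (t • z) := hA.continuous.comp ht
    have cg : Continuous fun t : ℝ ↦ g (t • z) := hg.comp ht
    exact ((cA.clm_apply continuous_const).clm_apply cg).intervalIntegrable _ _
  have hcontr : ∀ (g h : E → F), Continuous g → Continuous h → ∀ K : ℝ,
      (∀ z ∈ B, ‖g z - h z‖ ≤ K) →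
      ∀ z ∈ B, ‖picardStep A f₀ g z - picardStep A f₀ h z‖ ≤ 1 / 4 * K := by
    intro g h hg hh K hK z hz
    have hK0 : 0 ≤ K := (norm_nonneg _).trans (hK z hz)
    simp only [picardStep, add_sub_add_left_eq_sub]
    rw [← intervalIntegral.integral_sub (hcont hg z) (hcont hh z)]
    have := intervalIntegral.norm_integral_le_of_norm_le_const (a := (0 : ℝ)) (b := 1)
      (f := fun t : ℝ ↦ A (t • z) z (g (t • z)) - A (t • z) z (h (t • z))) (C := 1 / 4 * K) ?_
    · simpa using this
    · intro t ht
      have hy := hray z hz t ht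
      rw [← map_sub]
      calc ‖A (t • z) z (g (t • z) - h (t • z))‖
          ≤ ‖A (t • z)‖ * ‖z‖ * ‖g (t • z) - h (t • z)‖ := (A (t • z)).le_opNorm₂ _ _
        _ ≤ 1 / 4 * K := by
            gcongr
            · exact hsmall z hz _ hy
            · exact hK _ hy
  -- The Picard iterates.
  let s : ℕ → E → F := fun k ↦ (picardStep A f₀)^[k] fun _ ↦ f₀
  have hs_succ : ∀ k, s (k + 1) = picardStep A f₀ (s k) := fun k ↦
    Function.iterate_succ_apply' _ _ _
  have hsC : ∀ k, ContDiff ℝ 1 (s k) := by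
    intro k
    induction k with
    | zero => exact contDiff_const
    | succ k ih => rw [hs_succ]; exact contDiff_picardStep hA ih
  have hs_zero : ∀ k, s k 0 = f₀ := by
    intro k
    cases k with
    | zero => rfl
    | succ k => rw [hs_succ]; simp [picardStep]
  have hdiff : ∀ k, ∀ z ∈ B, ‖s (k + 1) z - s k z‖ ≤ ‖f₀‖ * (1 / 4) ^ k := by
    intro k
    induction k with
    | zero =>
      intro z hz
      rw [hs_succ]
      simp only [s, Function.iterate_zero, id, picardStep, add_sub_cancel_left]
      have := intervalIntegral.norm_integral_le_of_norm_le_const (a := (0 : ℝ)) (b := 1)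
        (f := fun t : ℝ ↦ A (t • z) z f₀) (C := 1 / 4 * ‖f₀‖) ?_
      · simp only [sub_zero, abs_one, mul_one] at this
        refine this.trans ?_
        have := norm_nonneg f₀
        simp only [pow_zero]
        linarith
      · intro t ht
        exact ((A (t • z)).le_opNorm₂ _ _).trans
          (mul_le_mul_of_nonneg_right (hsmall z hz _ (hray z hz t ht)) (norm_nonneg _))
    | succ k ih =>
      intro z hz
      have := hcontr _ _ (hsC (k + 1)).continuous (hsC k).continuous _ ih z hz
      rw [hs_succ (k + 1), hs_succ k] at *
      refine this.trans (le_of_eq ?_)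
      ring
  have hdef : ∀ k, ∀ z ∈ B, ‖defect A (s k) z‖ ≤ 4 * C * ‖f₀‖ * (3 / 4) ^ k := by
    intro k
    induction k with
    | zero =>
      intro z hz
      have : defect A (s 0) z = - (A z).flip f₀ := by
        simp [defect, s]
      rw [this, norm_neg]
      calc ‖(A z).flip f₀‖ ≤ ‖(A z).flip‖ * ‖f₀‖ := ContinuousLinearMap.le_opNorm _ _
        _ ≤ C * ‖f₀‖ := by
            rw [ContinuousLinearMap.opNorm_flip]
            gcongr
            exact hAB z hz
        _ ≤ _ := by
            have : 0 ≤ C * ‖f₀‖ := by positivity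
            simp only [pow_zero, mul_one]
            linarith
    | succ k ih =>
      intro z hz
      set K := 4 * C * ‖f₀‖ * (3 / 4) ^ k with hK
      have hK0 : 0 ≤ K := by positivity
      refine ContinuousLinearMap.opNorm_le_bound _ (by positivity) fun u ↦ ?_
      have e1 : defect A (s (k + 1)) z u = A z u (s k z - s (k + 1) z)
          + ∫ t in (0 : ℝ)..1, t • (A (t • z) z (defect A (s k) (t • z) u)
            - A (t • z) u (defect A (s k) (t • z) z)) := by
        rw [defect, hs_succ, sub_apply,
          fderiv_picardStep hA (hsC k) hint (hBr hz) u]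
        simp only [ContinuousLinearMap.flip_apply, map_sub]
        abel
      have e2 : ‖∫ t in (0 : ℝ)..1, t • (A (t • z) z (defect A (s k) (t • z) u)
            - A (t • z) u (defect A (s k) (t • z) z))‖ ≤ 1 / 2 * K * ‖u‖ := by
        have := intervalIntegral.norm_integral_le_of_norm_le_const (a := (0 : ℝ)) (b := 1)
          (f := fun t : ℝ ↦ t • (A (t • z) z (defect A (s k) (t • z) u)
            - A (t • z) u (defect A (s k) (t • z) z))) (C := 1 / 2 * K * ‖u‖) ?_
        · simpa using this
        · intro t ht
          have hy := hray z hz t ht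
          have hG := ih _ hy
          rw [uIoc_of_le zero_le_one] at ht
          rw [norm_smul, Real.norm_of_nonneg ht.1.le]
          refine (mul_le_of_le_one_left (norm_nonneg _) ht.2).trans
            ((norm_sub_le _ _).trans ?_)
          have b1 : ‖A (t • z) z (defect A (s k) (t • z) u)‖ ≤ 1 / 4 * (K * ‖u‖) :=
            ((A (t • z)).le_opNorm₂ _ _).trans (by
              gcongr
              · exact hsmall z hz _ hy
              · exact ContinuousLinearMap.le_of_opNorm_le _ hG _)
          have b2 : ‖A (t • z) u (defect A (s k) (t • z) z)‖ ≤ 1 / 4 * (K * ‖u‖) := by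
            calc _ ≤ ‖A (t • z)‖ * ‖u‖ * ‖defect A (s k) (t • z) z‖ := (A (t • z)).le_opNorm₂ _ _
              _ ≤ ‖A (t • z)‖ * ‖u‖ * (K * ‖z‖) := by
                  gcongr
                  exact ContinuousLinearMap.le_of_opNorm_le _ hG _
              _ = (‖A (t • z)‖ * ‖z‖) * (K * ‖u‖) := by ring
              _ ≤ _ := by
                  gcongr
                  exact hsmall z hz _ hy
          linarith
      have e3 : ‖A z u (s k z - s (k + 1) z)‖ ≤ 1 / 4 * K * ‖u‖ := by
        calc _ ≤ ‖A z‖ * ‖u‖ * ‖s k z - s (k + 1) z‖ := (A z).le_opNorm₂ _ _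
          _ ≤ C * ‖u‖ * (‖f₀‖ * (3 / 4) ^ k) := by
              gcongr
              · exact hAB z hz
              · rw [norm_sub_rev]
                refine (hdiff k z hz).trans ?_
                gcongr
                norm_num
          _ = _ := by rw [hK]; ring
      rw [e1]
      refine (norm_add_le _ _).trans ?_
      rw [pow_succ, ← mul_assoc, ← hK]
      linarith
  have hcau : ∀ z ∈ B, ∀ k m : ℕ, k ≤ m → ‖s m z - s k z‖ ≤ 2 * ‖f₀‖ * (1 / 4) ^ k := by
    intro z hz k m hkm
    have : ∀ j : ℕ, ‖s (k + j) z - s k z‖ ≤ 2 * ‖f₀‖ * ((1 / 4) ^ k - (1 / 4) ^ (k + j)) := by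
      intro j
      induction j with
      | zero => simp
      | succ j ih =>
        have h1 := hdiff (k + j) z hz
        have h2 := norm_add_le (s (k + j + 1) z - s (k + j) z) (s (k + j) z - s k z)
        rw [sub_add_sub_cancel] at h2
        have h3 : (0 : ℝ) ≤ ‖f₀‖ * (1 / 4) ^ (k + j) := by positivity
        rw [← add_assoc, pow_succ (1 / 4 : ℝ) (k + j)]
        nlinarith
    obtain ⟨j, rfl⟩ := Nat.exists_eq_add_of_le hkm
    refine (this j).trans ?_
    gcongr
    have : (0 : ℝ) ≤ (1 / 4) ^ (k + j) := by positivity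
    linarith
  have hlim : ∀ z ∈ B, ∃ l, Tendsto (fun k ↦ s k z) atTop (𝓝 l) := by
    intro z hz
    refine cauchySeq_tendsto_of_complete (cauchySeq_of_le_geometric (1 / 4) ‖f₀‖ (by norm_num) ?_)
    intro k
    rw [dist_comm, dist_eq_norm]
    exact hdiff k z hz
  choose! f hf using hlim
  have hfk : ∀ z ∈ B, ∀ k, ‖f z - s k z‖ ≤ 2 * ‖f₀‖ * (1 / 4) ^ k := fun z hz k ↦
    le_of_tendsto ((hf z hz).sub_const _).norm
      (eventually_atTop.2 ⟨k, fun m hm ↦ hcau z hz k m hm⟩)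
  refine ⟨ρ, hρ0, f, ?_, ?_⟩
  · exact tendsto_nhds_unique (hf 0 (Metric.mem_ball_self hρ0)) (by simp [hs_zero])
  · intro z hz
    refine hasFDerivAt_of_tendstoUniformlyOn (f := s) (f' := fun k y ↦ fderiv ℝ (s k) y)
      (g' := fun y ↦ (A y).flip (f y)) (l := atTop) Metric.isOpen_ball ?_
      (fun k y _ ↦ ((hsC k).differentiable (by simp) y).hasFDerivAt) hf hz
    have hbound : ∀ k, ∀ y ∈ B, ‖(A y).flip (f y) - fderiv ℝ (s k) y‖ ≤
        6 * C * ‖f₀‖ * (3 / 4) ^ k := by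
      intro k y hy
      have e : (A y).flip (f y) - fderiv ℝ (s k) y =
          (A y).flip (f y - s k y) - defect A (s k) y := by
        rw [defect, map_sub]
        abel
      rw [e]
      refine (norm_sub_le _ _).trans ?_
      have h1 : ‖(A y).flip (f y - s k y)‖ ≤ C * (2 * ‖f₀‖ * (3 / 4) ^ k) := by
        refine (ContinuousLinearMap.le_opNorm _ _).trans ?_
        rw [ContinuousLinearMap.opNorm_flip]
        gcongr
        · exact hAB y hy
        · refine (hfk y hy k).trans ?_
          gcongr
          norm_num
      have h2 := hdef k y hy
      calc _ ≤ C * (2 * ‖f₀‖ * (3 / 4) ^ k) + 4 * C * ‖f₀‖ * (3 / 4) ^ k := add_le_add h1 h2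
        _ = _ := by ring
    rw [Metric.tendstoUniformlyOn_iff]
    intro ε hε
    have hgeo : Tendsto (fun k : ℕ ↦ 6 * C * ‖f₀‖ * (3 / 4 : ℝ) ^ k) atTop (𝓝 0) := by
      simpa using (tendsto_pow_atTop_nhds_zero_of_lt_one (by norm_num : (0 : ℝ) ≤ 3 / 4)
        (by norm_num)).const_mul (6 * C * ‖f₀‖)
    filter_upwards [hgeo.eventually (gt_mem_nhds hε)] with k hk y hy
    rw [dist_eq_norm]
    exact (hbound k y hy).trans_lt hk

end Frobenius

section FrobeniusSmooth

variable {E F : Type*} [NormedAddCommGroup E] [NormedSpace ℝ E] [NormedAddCommGroup F]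
  [NormedSpace ℝ F]

theorem contDiffOn_of_hasFDerivAt_linear {A : E → E →L[ℝ] F →L[ℝ] F} {V : Set E} (hV : IsOpen V)
    (hA : ContDiffOn ℝ ∞ A V) {f : E → F} (hf : ∀ z ∈ V, HasFDerivAt f ((A z).flip (f z)) z) :
    ContDiffOn ℝ ∞ f V := by
  have hd : DifferentiableOn ℝ f V := fun z hz ↦ (hf z hz).differentiableAt.differentiableWithinAt
  rw [contDiffOn_infty]
  intro k
  induction k with
  | zero => exact contDiffOn_zero.2 hd.continuousOn
  | succ k ih =>
    rw [Nat.cast_succ, contDiffOn_succ_iff_fderiv_of_isOpen hV]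
    refine ⟨hd, by simp, ?_⟩
    have hflip : ContDiffOn ℝ k (fun z ↦ (A z).flip) V :=
      (ContinuousLinearMap.flipₗᵢ ℝ E F F).contDiff.comp_contDiffOn
        (hA.of_le (by exact_mod_cast (le_top : (k : ℕ∞) ≤ ⊤)))
    exact (hflip.clm_apply ih).congr fun z hz ↦ (hf z hz).fderiv

/-- The Frobenius theorem for a linear system `Df = A f` with smooth coefficients on an open set. -/
theorem exists_contDiffOn_of_integrable [FiniteDimensional ℝ E] [CompleteSpace F]
    {A : E → E →L[ℝ] F →L[ℝ] F} {V : Set E} (hV : IsOpen V) {z₀ : E} (hz₀ : z₀ ∈ V)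
    (hA : ContDiffOn ℝ ∞ A V)
    (hint : ∀ z ∈ V, ∀ (u v : E) (a : F),
      fderiv ℝ A z u v a + A z v (A z u a) = fderiv ℝ A z v u a + A z u (A z v a)) (f₀ : F) :
    ∃ W ⊆ V, IsOpen W ∧ z₀ ∈ W ∧ ∃ f : E → F, f z₀ = f₀ ∧ ContDiffOn ℝ ∞ f W ∧
      ∀ z ∈ W, HasFDerivAt f ((A z).flip (f z)) z := by
  obtain ⟨R, hR, hRV⟩ := Metric.isOpen_iff.1 hV z₀ hz₀
  let χ : ContDiffBump z₀ := ⟨R / 4, R / 2, by positivity, by linarith⟩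
  -- Cut off `A` away from `z₀` and move `z₀` to the origin.
  let A' : E → E →L[ℝ] F →L[ℝ] F := fun z ↦ χ z • A z
  have hA' : ContDiff ℝ 1 A' := by
    rw [contDiff_iff_contDiffAt]
    intro z
    by_cases hz : z ∈ V
    · exact χ.contDiffAt.smul ((hA.contDiffAt (hV.mem_nhds hz)).of_le (by simp))
    · have : z ∉ tsupport χ := by
        rw [χ.tsupport_eq]
        exact fun h ↦ hz (hRV (Metric.closedBall_subset_ball (half_lt_self hR) h))
      refine (contDiffAt_const (c := (0 : E →L[ℝ] F →L[ℝ] F))).congr_of_eventuallyEq ?_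
      filter_upwards [(notMem_tsupport_iff_eventuallyEq.1 this)] with y hy
      simp only [A', hy, Pi.zero_apply, zero_smul]
  have hAA' : ∀ z ∈ Metric.ball z₀ (R / 4), A' z = A z := fun z hz ↦ by
    simp [A', χ.one_of_mem_closedBall (Metric.ball_subset_closedBall hz)]
  have hBV : Metric.ball z₀ (R / 4) ⊆ V :=
    (Metric.ball_subset_ball (by linarith)).trans hRV
  have hsh : ∀ z, fderiv ℝ (fun y ↦ A' (z₀ + y)) z = fderiv ℝ A' (z₀ + z) := fun z ↦
    fderiv_comp_add_left (𝕜 := ℝ) (f := A') z₀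
  have hmem : ∀ {ρ : ℝ} {z : E}, z ∈ Metric.ball (0 : E) ρ → z₀ + z ∈ Metric.ball z₀ ρ := by
    intro ρ z hz
    simpa [dist_eq_norm] using hz
  obtain ⟨ρ, hρ, f, hf0, hf⟩ := exists_hasFDerivAt_of_integrable (A := fun y ↦ A' (z₀ + y))
    (hA'.comp (contDiff_const.add contDiff_id)) (r := R / 4) (by positivity) (by
      intro z hz u v a
      have hz' := hmem hz
      have hev : A' =ᶠ[𝓝 (z₀ + z)] A := by
        filter_upwards [Metric.isOpen_ball.mem_nhds hz'] with y hy using hAA' y hy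
      simp only [hsh, hev.fderiv_eq, hAA' _ hz']
      exact hint _ (hBV hz') u v a) f₀
  have hW : ∀ z ∈ Metric.ball z₀ (min ρ (R / 4)),
      HasFDerivAt (fun y ↦ f (y - z₀)) ((A z).flip (f (z - z₀))) z := by
    intro z hz
    have h1 : z - z₀ ∈ Metric.ball (0 : E) ρ := by
      rw [mem_ball_zero_iff, ← dist_eq_norm]
      exact Metric.ball_subset_ball (min_le_left _ _) hz
    have h2 := hf _ h1
    rw [add_sub_cancel, hAA' z (Metric.ball_subset_ball (min_le_right _ _) hz)] at h2
    simpa [Function.comp_def] using h2.comp z ((hasFDerivAt_id z).sub_const z₀)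
  have hWV : Metric.ball z₀ (min ρ (R / 4)) ⊆ V :=
    (Metric.ball_subset_ball (min_le_right _ _)).trans hBV
  refine ⟨_, hWV, Metric.isOpen_ball, Metric.mem_ball_self (by positivity), fun y ↦ f (y - z₀), ?_,
    ?_, hW⟩
  · simpa using hf0
  · exact contDiffOn_of_hasFDerivAt_linear Metric.isOpen_ball (hA.mono hWV) hW

end FrobeniusSmooth

/-! ### Algebraic curvature tensors -/

section Algebra

variable {E : Type*} [AddCommGroup E] [Module ℝ E]

/-- The Ricci contraction `Ric(u, v) = tr (w ↦ R(w, u) v)` of a curvature-type tensor. -/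
def ricOf (R : E →ₗ[ℝ] E →ₗ[ℝ] E →ₗ[ℝ] E) (u v : E) : ℝ :=
  LinearMap.trace ℝ E ((R.flip u).flip v)

/-- The projective Schouten tensor of a curvature-type tensor. -/
def schOf (R : E →ₗ[ℝ] E →ₗ[ℝ] E →ₗ[ℝ] E) (u v : E) : ℝ :=
  ((finrank ℝ E : ℝ) * ricOf R u v + ricOf R v u) / ((finrank ℝ E : ℝ) ^ 2 - 1)

/-- The projective Weyl tensor of a curvature-type tensor. -/
def weylOf (R : E →ₗ[ℝ] E →ₗ[ℝ] E →ₗ[ℝ] E) (u v w : E) : E :=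
  R u v w - (schOf R v w • u - schOf R u w • v) - (schOf R v u - schOf R u v) • w

variable [FiniteDimensional ℝ E]

/-- The projective Weyl tensor does not change when the curvature changes as it does under a
projective change of connection: the Schouten tensor then changes by `-Q`. -/
theorem weylOf_eq_of_projective_change (hn : 2 ≤ finrank ℝ E) {R R' : E →ₗ[ℝ] E →ₗ[ℝ] E →ₗ[ℝ] E}
    (Q : E →ₗ[ℝ] E →ₗ[ℝ] ℝ)
    (h : ∀ u v w, R' u v w = R u v w + (Q u v - Q v u) • w + Q u w • v - Q v w • u) :
    weylOf R' = weylOf R := by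
  have hric : ∀ u v, ricOf R' u v = ricOf R u v + Q v u - finrank ℝ E * Q u v := by
    intro u v
    have : (R'.flip u).flip v = (R.flip u).flip v + (Q.flip u - Q u).smulRight v
        + (Q.flip v).smulRight u - Q u v • LinearMap.id := by
      ext w
      simp [h]
    simp only [ricOf, this, map_add, map_sub, map_smul, LinearMap.trace_smulRight,
      LinearMap.trace_id, LinearMap.flip_apply, LinearMap.sub_apply, smul_eq_mul]
    ring
  have hN : (2 : ℝ) ≤ finrank ℝ E := by exact_mod_cast hn
  have hN' : (finrank ℝ E : ℝ) ^ 2 - 1 ≠ 0 := by nlinarith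
  have hsch : ∀ u v, schOf R' u v = schOf R u v - Q u v := by
    intro u v
    simp only [schOf, hric]
    field_simp
    ring
  ext u v w
  simp only [weylOf, hsch, h]
  module

/-- In dimension three, a tensor with the symmetries of the curvature of a metric vanishes if its
Ricci contraction does. Here `T` consists of the components in an orthogonal basis whose vectors
have the squares `ε i`. -/
theorem curvature_components_eq_zero {T : Fin 3 → Fin 3 → Fin 3 → Fin 3 → ℝ} {ε : Fin 3 → ℝ}
    (hε : ∀ i, ε i ≠ 0) (h12 : ∀ i j k l, T i j k l = -T j i k l)
    (h34 : ∀ i j k l, T i j k l = -T i j l k)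
    (hB : ∀ i j k l, T i j k l + T j k i l + T k i j l = 0)
    (hric : ∀ j k, ∑ i, T i j k i / ε i = 0) (i j k l : Fin 3) : T i j k l = 0 := by
  -- The pair symmetry, a combination of four instances of the Bianchi identity.
  have hpair : ∀ i j k l, T i j k l = T k l i j := by
    intro i j k l
    linarith [hB i j k l, hB j k l i, hB k l i j, hB l i j k, h12 i j k l, h12 j k i l, h12 k i j l,
      h12 j k l i, h12 k l j i, h12 l j k i, h12 k l i j, h12 l i k j, h12 i k l j, h12 l i j k,
      h12 i j l k, h12 j l i k, h34 i j k l, h34 j k i l, h34 k i j l, h34 j k l i, h34 k l j i,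
      h34 l j k i, h34 k l i j, h34 l i k j, h34 i k l j, h34 l i j k, h34 i j l k, h34 j l i k]
  have hd : ∀ i k l, T i i k l = 0 := fun i k l ↦ by linarith [h12 i i k l]
  have hd' : ∀ i j k, T i j k k = 0 := fun i j k ↦ by linarith [h34 i j k k]
  simp only [Fin.sum_univ_three] at hric
  have e0 := hε 0
  have e1 := hε 1
  have e2 := hε 2
  -- The off-diagonal components of the Ricci tensor have one term each.
  have o01 : T 2 0 1 2 = 0 := by
    have := hric 0 1
    rw [hd, hd'] at this
    simpa [e2] using this
  have o02 : T 1 0 2 1 = 0 := by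
    have := hric 0 2
    rw [hd, hd'] at this
    simpa [e1] using this
  have o12 : T 0 1 2 0 = 0 := by
    have := hric 1 2
    rw [hd, hd'] at this
    simpa [e0] using this
  -- The diagonal components of the Ricci tensor determine the three sectional curvatures.
  have d0 := hric 0 0
  have d1 := hric 1 1
  have d2 := hric 2 2
  rw [hd] at d0 d1 d2
  have s01 : T 1 0 0 1 = T 0 1 1 0 := by linarith [h12 1 0 0 1, h34 0 1 0 1]
  have s02 : T 2 0 0 2 = T 0 2 2 0 := by linarith [h12 2 0 0 2, h34 0 2 0 2]
  have s12 : T 2 1 1 2 = T 1 2 2 1 := by linarith [h12 2 1 1 2, h34 1 2 1 2]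
  rw [s01, s02] at d0
  rw [s12] at d1
  replace d0 : ε 0 * (T 0 1 1 0 * ε 2 + T 0 2 2 0 * ε 1) = 0 := by
    field_simp at d0
    linear_combination d0
  replace d1 : ε 1 * (T 0 1 1 0 * ε 2 + T 1 2 2 1 * ε 0) = 0 := by
    field_simp at d1
    linear_combination d1
  replace d2 : ε 2 * (T 0 2 2 0 * ε 1 + T 1 2 2 1 * ε 0) = 0 := by
    field_simp at d2
    linear_combination d2
  replace d0 := (mul_eq_zero.1 d0).resolve_left e0
  replace d1 := (mul_eq_zero.1 d1).resolve_left e1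
  replace d2 := (mul_eq_zero.1 d2).resolve_left e2
  have a01 : T 0 1 1 0 = 0 := by
    have : T 0 1 1 0 * (2 * ε 2) = 0 := by linear_combination d0 + d1 - d2
    simpa [e2] using this
  have a02 : T 0 2 2 0 = 0 := by
    have : T 0 2 2 0 * (2 * ε 1) = 0 := by linear_combination d0 + d2 - d1
    simpa [e1] using this
  have a12 : T 1 2 2 1 = 0 := by
    have : T 1 2 2 1 * (2 * ε 0) = 0 := by linear_combination d1 + d2 - d0
    simpa [e0] using this
  have hbase : ∀ i j k l : Fin 3, i < j → k < l → T i j k l = 0 := by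
    intro i j k l hij hkl
    fin_cases i <;> fin_cases j <;> (first | exact absurd hij (by decide) | skip) <;>
      fin_cases k <;> fin_cases l <;> (first | exact absurd hkl (by decide) | skip) <;>
      simp only [Fin.zero_eta, Fin.mk_one, Fin.reduceFinMk] <;>
      linarith [h34 0 1 0 1, h34 0 2 0 2, h34 1 2 1 2, h12 0 1 1 2, h12 0 1 0 2, h34 0 1 0 2,
        hpair 0 1 0 2, hpair 0 1 1 2, hpair 0 2 1 2, h12 2 0 1 2, h12 1 0 2 1, h34 0 1 2 1,
        h34 0 1 1 2, h34 0 1 2 0, h12 1 0 0 2]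
  have hbase' : ∀ i j k l : Fin 3, i < j → T i j k l = 0 := by
    intro i j k l hij
    rcases lt_trichotomy k l with h | rfl | h
    · exact hbase i j k l hij h
    · exact hd' i j k
    · rw [h34, hbase i j l k hij h, neg_zero]
  rcases lt_trichotomy i j with h | rfl | h
  · exact hbase' i j k l h
  · exact hd i k l
  · rw [h12, hbase' j i k l h, neg_zero]

/-- In dimension three, a curvature tensor of a metric `g` with `Ric = c g` has constant
curvature, and so its projective Weyl tensor vanishes. -/
theorem weylOf_eq_zero_of_einstein (hn : finrank ℝ E = 3) {R : E →ₗ[ℝ] E →ₗ[ℝ] E →ₗ[ℝ] E}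
    {g : LinearMap.BilinForm ℝ E} (hsymm : ∀ v w, g v w = g w v)
    (hnd : ∀ v, (∀ w, g v w = 0) → v = 0) (h12 : ∀ u v w, R u v w = -R v u w)
    (hB : ∀ u v w, R u v w + R v w u + R w u v = 0)
    (h34 : ∀ u v w x, g (R u v w) x + g w (R u v x) = 0) {c : ℝ}
    (hric : ∀ u v, ricOf R u v = c * g u v) (u v w : E) : weylOf R u v w = 0 := by
  obtain ⟨b, hb⟩ := LinearMap.BilinForm.exists_orthogonal_basis (B := g) ⟨fun v w ↦ hsymm v w⟩
  let b' : Basis (Fin 3) ℝ E := b.reindex (finCongr hn)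
  have hb' : ∀ i j, i ≠ j → g (b' i) (b' j) = 0 := by
    intro i j hij
    have := hb (i := (finCongr hn).symm i) (j := (finCongr hn).symm j) (by simpa using hij)
    simpa [b'] using this
  have hexp : ∀ x j, g x (b' j) = b'.repr x j * g (b' j) (b' j) := by
    intro x j
    conv_lhs => rw [← b'.sum_repr x]
    rw [map_sum, LinearMap.sum_apply, Finset.sum_eq_single j]
    · simp
    · intro i _ hij
      simp [hb' i j hij]
    · simp
  have hε : ∀ i, g (b' i) (b' i) ≠ 0 := by
    intro i hi
    refine b'.ne_zero i (hnd _ fun w ↦ ?_)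
    rw [hsymm, hexp, hi, mul_zero]
  have htr : ∀ f : E →ₗ[ℝ] E, LinearMap.trace ℝ E f
      = ∑ i, g (f (b' i)) (b' i) / g (b' i) (b' i) := by
    intro f
    rw [LinearMap.trace_eq_matrix_trace ℝ b', Matrix.trace]
    refine Finset.sum_congr rfl fun i _ ↦ ?_
    rw [hexp, mul_div_cancel_right₀ _ (hε i), Matrix.diag_apply, LinearMap.toMatrix_apply]
  -- The difference of `R` and the constant-curvature tensor with the same Ricci contraction.
  let S : E → E → E → E := fun u v w ↦ R u v w - (c / 2) • (g v w • u - g u w • v)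
  have hS : ∀ i j k l, g (S (b' i) (b' j) (b' k)) (b' l) = 0 := by
    intro i j k l
    refine curvature_components_eq_zero (T := fun i j k l ↦ g (S (b' i) (b' j) (b' k)) (b' l))
      (ε := fun i ↦ g (b' i) (b' i)) hε ?_ ?_ ?_ ?_ i j k l
    · intro i j k l
      simp only [S, h12 (b' i) (b' j), map_sub, map_neg, map_smul, LinearMap.sub_apply,
        LinearMap.neg_apply, LinearMap.smul_apply, smul_eq_mul]
      ring
    · intro i j k l
      have := h34 (b' i) (b' j) (b' k) (b' l)
      rw [hsymm (b' k)] at this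
      simp only [S, map_sub, map_smul, LinearMap.sub_apply,
        LinearMap.smul_apply, smul_eq_mul]
      linear_combination this
    · intro i j k l
      have := congrArg (fun x ↦ g x (b' l)) (hB (b' i) (b' j) (b' k))
      simp only [map_add, LinearMap.add_apply, map_zero, LinearMap.zero_apply] at this
      simp only [S, map_sub, map_smul, LinearMap.sub_apply,
        LinearMap.smul_apply, smul_eq_mul]
      rw [hsymm (b' k) (b' i), hsymm (b' j) (b' i), hsymm (b' k) (b' j)]
      linear_combination this
    · intro j k
      have h1 := hric (b' j) (b' k)
      rw [ricOf, htr] at h1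
      simp only [LinearMap.flip_apply] at h1
      have h2 : ∀ i, g (S (b' i) (b' j) (b' k)) (b' i) / g (b' i) (b' i) =
          g (R (b' i) (b' j) (b' k)) (b' i) / g (b' i) (b' i) -
            (c / 2) * (g (b' j) (b' k) - b'.repr (b' j) i * g (b' i) (b' k)) := by
        intro i
        simp only [S, map_sub, map_smul, LinearMap.sub_apply,
          LinearMap.smul_apply, smul_eq_mul]
        rw [hexp (b' j) i]
        field_simp [hε i]
      rw [Finset.sum_congr rfl fun i _ ↦ h2 i, Finset.sum_sub_distrib, h1, ← Finset.mul_sum,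
        Finset.sum_sub_distrib]
      have h3 : ∑ i, b'.repr (b' j) i * g (b' i) (b' k) = g (b' j) (b' k) := by
        conv_rhs => rw [← b'.sum_repr (b' j)]
        simp
      rw [h3]
      simp
      ring
  have hR : ∀ u v w, R u v w = (c / 2) • (g v w • u - g u w • v) := by
    let S' : E →ₗ[ℝ] E →ₗ[ℝ] E →ₗ[ℝ] E := LinearMap.mk₂ ℝ
      (fun u v ↦ R u v - (c / 2) • ((g v).smulRight u - (g u).smulRight v))
      (by intros; ext; simp; module) (by intros; ext; simp; module)
      (by intros; ext; simp; module) (by intros; ext; simp; module)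
    have hS' : S' = 0 := by
      refine b'.ext fun i ↦ b'.ext fun j ↦ b'.ext fun k ↦ ?_
      refine b'.ext_elem fun l ↦ ?_
      have := hS i j k l
      rw [hexp] at this
      have h0 := (mul_eq_zero.1 this).resolve_right (hε l)
      simpa [S', S] using h0
    intro u v w
    have := congrArg (fun T : E →ₗ[ℝ] E →ₗ[ℝ] E →ₗ[ℝ] E ↦ T u v w) hS'
    simp only [S', LinearMap.mk₂_apply, LinearMap.sub_apply, LinearMap.smul_apply,
      LinearMap.smulRight_apply, LinearMap.zero_apply] at this
    exact sub_eq_zero.1 this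
  have hsch : ∀ u v, schOf R u v = (c / 2) * g u v := by
    intro u v
    rw [schOf, hric, hric, hn, hsymm v u]
    push_cast
    ring
  rw [weylOf, hR, hsch, hsch, hsch, hsch, hsymm v u]
  module

end Algebra

/-! ### Curvature of Christoffel symbols and projective changes -/

section CoordinateCurvature

variable {E : Type*} [NormedAddCommGroup E] [NormedSpace ℝ E]

theorem two_le_infty : (2 : ℕ∞ω) ≤ ∞ :=
  WithTop.coe_le_coe.2 (le_top : (2 : ℕ∞) ≤ ⊤)

/-- The curvature `R(u, v) w` built from the Christoffel symbol `G` at a point and its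
derivative `D` there. -/
def riemOf (D : E →L[ℝ] E →L[ℝ] E →L[ℝ] E) (G : E →L[ℝ] E →L[ℝ] E) :
    E →ₗ[ℝ] E →ₗ[ℝ] E →ₗ[ℝ] E :=
  LinearMap.mk₂ ℝ
    (fun u v ↦ ((D u v - D v u + (G u).comp (G v) - (G v).comp (G u) : E →L[ℝ] E) : E →ₗ[ℝ] E))
    (by intros; ext; simp; abel) (by intros; ext; simp; module)
    (by intros; ext; simp; abel) (by intros; ext; simp; module)

theorem riemOf_apply (D : E →L[ℝ] E →L[ℝ] E →L[ℝ] E) (G : E →L[ℝ] E →L[ℝ] E) (u v w : E) :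
    riemOf D G u v w = D u v w - D v u w + G u (G v w) - G v (G u w) := by
  simp [riemOf]

/-- The curvature of the Christoffel symbol `Γ` at `z`. -/
def riem (Γ : E → E →L[ℝ] E →L[ℝ] E) (z : E) : E →ₗ[ℝ] E →ₗ[ℝ] E →ₗ[ℝ] E :=
  riemOf (fderiv ℝ Γ z) (Γ z)

theorem riem_apply (Γ : E → E →L[ℝ] E →L[ℝ] E) (z u v w : E) :
    riem Γ z u v w = fderiv ℝ Γ z u v w - fderiv ℝ Γ z v u w + Γ z u (Γ z v w)
      - Γ z v (Γ z u w) :=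
  riemOf_apply _ _ _ _ _

theorem riem_antisymm (Γ : E → E →L[ℝ] E →L[ℝ] E) (z u v w : E) :
    riem Γ z u v w = -riem Γ z v u w := by
  simp only [riem_apply]
  abel

theorem fderiv_apply_apply {F G H : Type*} [NormedAddCommGroup F] [NormedSpace ℝ F]
    [NormedAddCommGroup G] [NormedSpace ℝ G] [NormedAddCommGroup H] [NormedSpace ℝ H]
    {f : E → F →L[ℝ] G →L[ℝ] H} {z : E} (hf : DifferentiableAt ℝ f z) (a : E) (b : F) (c : G) :
    fderiv ℝ (fun y ↦ f y b c) z a = fderiv ℝ f z a b c := by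
  have := ((hf.hasFDerivAt.clm_apply (hasFDerivAt_const b z)).clm_apply
    (hasFDerivAt_const c z)).fderiv
  rw [this]
  simp

theorem fderiv_symm_of_eventually {Γ : E → E →L[ℝ] E →L[ℝ] E} {z : E}
    (hΓ : DifferentiableAt ℝ Γ z) (hs : ∀ᶠ y in 𝓝 z, ∀ u v, Γ y u v = Γ y v u) (a u v : E) :
    fderiv ℝ Γ z a u v = fderiv ℝ Γ z a v u := by
  rw [← fderiv_apply_apply hΓ, ← fderiv_apply_apply hΓ]
  refine congrArg (fun L : E →L[ℝ] E ↦ L a) (EventuallyEq.fderiv_eq ?_)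
  filter_upwards [hs] with y hy using hy u v

/-- The first Bianchi identity. -/
theorem riem_bianchi {Γ : E → E →L[ℝ] E →L[ℝ] E} {z : E}
    (hΓ : DifferentiableAt ℝ Γ z) (hs : ∀ᶠ y in 𝓝 z, ∀ u v, Γ y u v = Γ y v u) (u v w : E) :
    riem Γ z u v w + riem Γ z v w u + riem Γ z w u v = 0 := by
  have h1 := fderiv_symm_of_eventually hΓ hs
  have h2 := hs.self_of_nhds
  simp only [riem_apply]
  rw [h1 u v w, h1 v w u, h1 w u v, h2 v w, h2 w u, h2 u v]
  abel

/-- The curvature of a metric connection is skew with respect to the metric, by the symmetry of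
the second derivative of the metric. -/
theorem riem_metric_skew {Γ : E → E →L[ℝ] E →L[ℝ] E} {g : E → E →L[ℝ] E →L[ℝ] ℝ} {z : E}
    (hΓ : DifferentiableAt ℝ Γ z) (hg : ContDiffAt ℝ ∞ g z)
    (hc : ∀ᶠ y in 𝓝 z, ∀ u v w, fderiv ℝ g y u v w = g y (Γ y u v) w + g y v (Γ y u w))
    (u v w x : E) : g z (riem Γ z u v w) x + g z w (riem Γ z u v x) = 0 := by
  have hgd := hg.differentiableAt (by simp)
  have hgd2 : DifferentiableAt ℝ (fderiv ℝ g) z :=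
    (hg.fderiv_right (m := 1) (by simp [one_add_one_eq_two, two_le_infty])).differentiableAt
      (by simp)
  have hsymm : IsSymmSndFDerivAt ℝ g z := hg.isSymmSndFDerivAt (by simp [two_le_infty])
  have key : ∀ a b, fderiv ℝ (fderiv ℝ g) z a b w x =
      g z (Γ z a (Γ z b w)) x + g z (Γ z b w) (Γ z a x) + g z (fderiv ℝ Γ z a b w) x
      + (g z (Γ z a w) (Γ z b x) + g z w (Γ z a (Γ z b x)) + g z w (fderiv ℝ Γ z a b x)) := by
    intro a b
    have hΓb : ∀ p, HasFDerivAt (fun y ↦ Γ y b p) ((fderiv ℝ Γ z).flip b |>.flip p) z := by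
      intro p
      refine ((hΓ.hasFDerivAt.clm_apply (hasFDerivAt_const b z)).clm_apply
        (hasFDerivAt_const p z)).congr_fderiv ?_
      ext
      simp
    have h1 := ((hgd.hasFDerivAt.clm_apply (hΓb w)).clm_apply (hasFDerivAt_const x z))
    have h2 := ((hgd.hasFDerivAt.clm_apply (hasFDerivAt_const w z)).clm_apply (hΓb x))
    have h3 : fderiv ℝ (fun y ↦ fderiv ℝ g y b w x) z a = fderiv ℝ (fderiv ℝ g) z a b w x := by
      have := (((hgd2.hasFDerivAt.clm_apply (hasFDerivAt_const b z)).clm_apply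
        (hasFDerivAt_const w z)).clm_apply (hasFDerivAt_const x z)).fderiv
      rw [this]
      simp
    have h4 : (fun y ↦ fderiv ℝ g y b w x) =ᶠ[𝓝 z]
        fun y ↦ g y (Γ y b w) x + g y w (Γ y b x) := by
      filter_upwards [hc] with y hy using hy b w x
    rw [← h3, h4.fderiv_eq]
    have h5 : fderiv ℝ (fun y ↦ g y (Γ y b w) x + g y w (Γ y b x)) z = _ := (h1.add h2).fderiv
    rw [h5]
    have hz := hc.self_of_nhds
    simp [hz]
    ring
  have h := congrArg (fun L : E →L[ℝ] E →L[ℝ] ℝ ↦ L w x) (hsymm u v)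
  simp only [key] at h
  simp only [riem_apply, map_add, map_sub, add_apply, sub_apply]
  linear_combination h

/-- A connection with a parallel coframe is flat, by the symmetry of the second derivative of the
coframe. -/
theorem riem_eq_zero_of_parallel_coframe {Γ : E → E →L[ℝ] E →L[ℝ] E} {θ : E → E →L[ℝ] E} {z : E}
    (hΓ : DifferentiableAt ℝ Γ z) (hθ : ContDiffAt ℝ ∞ θ z)
    (hp : ∀ᶠ y in 𝓝 z, ∀ u v, fderiv ℝ θ y u v = θ y (Γ y u v))
    (hinj : Function.Injective (θ z)) : riem Γ z = 0 := by
  have hθd := hθ.differentiableAt (by simp)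
  have hθd2 : DifferentiableAt ℝ (fderiv ℝ θ) z :=
    (hθ.fderiv_right (m := 1) (by simp [one_add_one_eq_two, two_le_infty])).differentiableAt
      (by simp)
  have hsymm : IsSymmSndFDerivAt ℝ θ z := hθ.isSymmSndFDerivAt (by simp [two_le_infty])
  have key : ∀ a b w, fderiv ℝ (fderiv ℝ θ) z a b w =
      θ z (Γ z a (Γ z b w)) + θ z (fderiv ℝ Γ z a b w) := by
    intro a b w
    rw [← fderiv_apply_apply hθd2]
    have h4 : (fun y ↦ fderiv ℝ θ y b w) =ᶠ[𝓝 z] fun y ↦ θ y (Γ y b w) := by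
      filter_upwards [hp] with y hy using hy b w
    have h1 := (hθd.hasFDerivAt.clm_apply ((hΓ.hasFDerivAt.clm_apply
      (hasFDerivAt_const b z)).clm_apply (hasFDerivAt_const w z)))
    rw [h4.fderiv_eq, h1.fderiv]
    have hz := hp.self_of_nhds
    simp [hz]
    abel
  ext u v w
  apply hinj
  have h := congrArg (fun L : E →L[ℝ] E ↦ L w) (hsymm u v)
  simp only [key] at h
  simp only [riem_apply, map_add, map_sub, LinearMap.zero_apply, map_zero]
  rw [← sub_eq_zero] at h
  rw [← h]
  abel

/-- The difference tensor `(u, v) ↦ υ(u) v + υ(v) u` of a projective change by the covector `υ`. -/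
def projTerm : (E →L[ℝ] ℝ) →ₗ[ℝ] E →L[ℝ] E →L[ℝ] E where
  toFun υ := υ.smulRight (ContinuousLinearMap.id ℝ E) +
    (υ.smulRight (ContinuousLinearMap.id ℝ E)).flip
  map_add' _ _ := by ext; simp; module
  map_smul' _ _ := by ext; simp; module

theorem projTerm_apply (υ : E →L[ℝ] ℝ) (u v : E) : projTerm υ u v = υ u • v + υ v • u := by
  simp [projTerm]

variable [FiniteDimensional ℝ E]

theorem hasFDerivAt_add_projTerm {Γ : E → E →L[ℝ] E →L[ℝ] E} {Υ : E → E →L[ℝ] ℝ} {z : E}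
    (hΓ : DifferentiableAt ℝ Γ z) (hΥ : DifferentiableAt ℝ Υ z) :
    HasFDerivAt (fun y ↦ Γ y + projTerm (Υ y))
      (fderiv ℝ Γ z + (LinearMap.toContinuousLinearMap projTerm).comp (fderiv ℝ Υ z)) z :=
  hΓ.hasFDerivAt.add
    ((LinearMap.toContinuousLinearMap (projTerm (E := E))).hasFDerivAt.comp z hΥ.hasFDerivAt)

theorem contDiffOn_add_projTerm {Γ : E → E →L[ℝ] E →L[ℝ] E} {Υ : E → E →L[ℝ] ℝ} {V : Set E}
    (hΓ : ContDiffOn ℝ ∞ Γ V) (hΥ : ContDiffOn ℝ ∞ Υ V) :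
    ContDiffOn ℝ ∞ (fun y ↦ Γ y + projTerm (Υ y)) V :=
  hΓ.add ((LinearMap.toContinuousLinearMap (projTerm (E := E))).contDiff.comp_contDiffOn hΥ)

/-- Projective invariance of the projective Weyl tensor. -/
theorem weylOf_riem_add_projTerm (hn : 2 ≤ finrank ℝ E) {Γ : E → E →L[ℝ] E →L[ℝ] E}
    {Υ : E → E →L[ℝ] ℝ} {z : E} (hΓ : DifferentiableAt ℝ Γ z) (hΥ : DifferentiableAt ℝ Υ z)
    (hs : ∀ u v, Γ z u v = Γ z v u) :
    weylOf (riem (fun y ↦ Γ y + projTerm (Υ y)) z) = weylOf (riem Γ z) := by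
  -- `Q` is `∇Υ - Υ ⊗ Υ`, by which the Schouten tensor changes.
  let Q : E →ₗ[ℝ] E →ₗ[ℝ] ℝ := LinearMap.mk₂ ℝ
    (fun u v ↦ fderiv ℝ Υ z u v - Υ z (Γ z u v) - Υ z u * Υ z v)
    (by intros; simp; ring) (by intros; simp; ring)
    (by intros; simp; ring) (by intros; simp; ring)
  refine weylOf_eq_of_projective_change hn Q fun u v w ↦ ?_
  simp only [riem_apply, (hasFDerivAt_add_projTerm hΓ hΥ).fderiv]
  simp only [add_apply, ContinuousLinearMap.comp_apply, LinearMap.coe_toContinuousLinearMap',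
    projTerm_apply, map_add, map_smul, Q, LinearMap.mk₂_apply]
  rw [hs v u]
  module

end CoordinateCurvature

/-! ### Projectively flat connections: Schouten and Cotton tensors -/

section ProjectiveFlatness

variable {E : Type*} [NormedAddCommGroup E] [NormedSpace ℝ E]

/-- The Ricci contraction as a bilinear map. -/
def ricBilin (R : E →ₗ[ℝ] E →ₗ[ℝ] E →ₗ[ℝ] E) : E →ₗ[ℝ] E →ₗ[ℝ] ℝ :=
  LinearMap.mk₂ ℝ (ricOf R)
    (fun u u' v ↦ by
      have : (R.flip (u + u')).flip v = (R.flip u).flip v + (R.flip u').flip v := by ext; simp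
      rw [ricOf, this, map_add]; rfl)
    (fun c u v ↦ by
      have : (R.flip (c • u)).flip v = c • (R.flip u).flip v := by ext; simp
      rw [ricOf, this, map_smul]; rfl)
    (fun u v v' ↦ by simp only [ricOf, map_add])
    (fun c u v ↦ by simp only [ricOf, map_smul])

variable {Γ : E → E →L[ℝ] E →L[ℝ] E} {V : Set E}

theorem contDiffOn_riem (hV : IsOpen V) (hΓ : ContDiffOn ℝ ∞ Γ V) (u v w : E) :
    ContDiffOn ℝ ∞ (fun z ↦ riem Γ z u v w) V := by
  simp only [riem_apply]
  have hD : ContDiffOn ℝ ∞ (fderiv ℝ Γ) V := hΓ.fderiv_of_isOpen hV (by simp)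
  have c : ∀ x : E, ContDiffOn ℝ ∞ (fun _ : E ↦ x) V := fun x ↦ contDiffOn_const
  exact ((((hD.clm_apply (c u)).clm_apply (c v)).clm_apply (c w)).sub
    (((hD.clm_apply (c v)).clm_apply (c u)).clm_apply (c w))).add
    ((hΓ.clm_apply (c u)).clm_apply ((hΓ.clm_apply (c v)).clm_apply (c w))) |>.sub
    ((hΓ.clm_apply (c v)).clm_apply ((hΓ.clm_apply (c u)).clm_apply (c w)))

variable [FiniteDimensional ℝ E]

variable (E) in
/-- The trace of continuous endomorphisms, as a continuous linear form. -/
def traceL : (E →L[ℝ] E) →L[ℝ] ℝ :=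
  LinearMap.toContinuousLinearMap (LinearMap.trace ℝ E ∘ₗ ContinuousLinearMap.coeLM ℝ)

theorem traceL_apply (f : E →L[ℝ] E) : traceL E f = LinearMap.trace ℝ E f := rfl

theorem traceL_projTerm (υ : E →L[ℝ] ℝ) (u : E) :
    traceL E (projTerm υ u) = (finrank ℝ E + 1) * υ u := by
  have : ((projTerm υ u : E →L[ℝ] E) : E →ₗ[ℝ] E) =
      υ u • LinearMap.id + (υ : E →ₗ[ℝ] ℝ).smulRight u := by
    ext v
    simp [projTerm_apply]
  rw [traceL_apply, this, map_add, map_smul, LinearMap.trace_id, LinearMap.trace_smulRight]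
  simp
  ring

/-- The Schouten tensor of a Christoffel symbol with symmetric Ricci tensor, `Ric / (n - 1)`. -/
def symmSchouten (Γ : E → E →L[ℝ] E →L[ℝ] E) (z : E) : E →L[ℝ] E →L[ℝ] ℝ :=
  (((finrank ℝ E : ℝ) - 1)⁻¹ • ricBilin (riem Γ z)).toContinuousBilinearMap

theorem symmSchouten_apply (Γ : E → E →L[ℝ] E →L[ℝ] E) (z u v : E) :
    symmSchouten Γ z u v = ((finrank ℝ E : ℝ) - 1)⁻¹ * ricOf (riem Γ z) u v := rfl

theorem contDiffOn_symmSchouten (hV : IsOpen V) (hΓ : ContDiffOn ℝ ∞ Γ V) :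
    ContDiffOn ℝ ∞ (symmSchouten Γ) V := by
  rw [contDiffOn_clm_apply]
  intro u
  rw [contDiffOn_clm_apply]
  intro v
  simp only [symmSchouten_apply]
  refine contDiffOn_const.mul ?_
  have : ContDiffOn ℝ ∞ (fun z ↦
      LinearMap.toContinuousLinearMap (((riem Γ z).flip u).flip v)) V := by
    rw [contDiffOn_clm_apply]
    exact fun w ↦ contDiffOn_riem hV hΓ w u v
  exact (traceL E).contDiff.comp_contDiffOn this

/-- Trace-free Christoffel symbols, i.e. those which preserve the standard volume of the chart,
have a symmetric Ricci tensor. -/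
theorem ricOf_riem_symm (hV : IsOpen V) (hΓ : ContDiffOn ℝ ∞ Γ V)
    (hs : ∀ z ∈ V, ∀ u v, Γ z u v = Γ z v u) (htr : ∀ z ∈ V, ∀ u, traceL E (Γ z u) = 0)
    {z : E} (hz : z ∈ V) (u v : E) : ricOf (riem Γ z) u v = ricOf (riem Γ z) v u := by
  have hΓz : DifferentiableAt ℝ Γ z := (hΓ.contDiffAt (hV.mem_nhds hz)).differentiableAt (by simp)
  have hD : ∀ a b, traceL E (fderiv ℝ Γ z a b) = 0 := by
    intro a b
    have h1 : HasFDerivAt (fun y ↦ traceL E (Γ y b))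
        ((traceL E).comp ((fderiv ℝ Γ z).flip b)) z :=
      ((traceL E).hasFDerivAt.comp z
        (hΓz.hasFDerivAt.clm_apply (hasFDerivAt_const b z))).congr_fderiv (by ext; simp)
    have h2 : (fun y ↦ traceL E (Γ y b)) =ᶠ[𝓝 z] fun _ ↦ 0 := by
      filter_upwards [hV.mem_nhds hz] with y hy using htr y hy b
    have h3 := h2.fderiv_eq (𝕜 := ℝ)
    rw [h1.fderiv] at h3
    have := congrArg (fun L : E →L[ℝ] ℝ ↦ L a) h3
    simpa using this
  have htrR : LinearMap.trace ℝ E (riem Γ z u v) = 0 := by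
    have : riem Γ z u v = ((fderiv ℝ Γ z u v : E →L[ℝ] E) : E →ₗ[ℝ] E)
        - ((fderiv ℝ Γ z v u : E →L[ℝ] E) : E →ₗ[ℝ] E)
        + ((Γ z u : E →ₗ[ℝ] E) * (Γ z v : E →ₗ[ℝ] E)
          - (Γ z v : E →ₗ[ℝ] E) * (Γ z u : E →ₗ[ℝ] E)) := by
      ext w
      simp [riem_apply]
      abel
    rw [this, map_add, map_sub, map_sub, LinearMap.trace_mul_comm, ← traceL_apply, ← traceL_apply,
      hD, hD]
    simp
  have hB := riem_bianchi hΓz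
    (by filter_upwards [hV.mem_nhds hz] with y hy using hs y hy)
  have h : ((riem Γ z).flip u).flip v = ((riem Γ z).flip v).flip u - riem Γ z u v := by
    ext w
    have := hB u v w
    simp only [LinearMap.flip_apply, LinearMap.sub_apply]
    rw [riem_antisymm Γ z v w u] at this
    rw [← sub_eq_zero, ← this]
    abel
  rw [ricOf, ricOf, h, map_sub, htrR, sub_zero]

theorem schOf_riem_eq (hn : 2 ≤ finrank ℝ E) {z : E}
    (hric : ∀ u v, ricOf (riem Γ z) u v = ricOf (riem Γ z) v u) (u v : E) :
    schOf (riem Γ z) u v = symmSchouten Γ z u v := by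
  have hN : (2 : ℝ) ≤ finrank ℝ E := by exact_mod_cast hn
  have h1 : (finrank ℝ E : ℝ) - 1 ≠ 0 := by linarith
  have h2 : (finrank ℝ E : ℝ) + 1 ≠ 0 := by linarith
  have h3 : (finrank ℝ E : ℝ) ^ 2 - 1 = (finrank ℝ E - 1) * (finrank ℝ E + 1) := by ring
  rw [schOf, symmSchouten_apply, hric v u, h3]
  field_simp

theorem riem_eq_of_weylOf_eq_zero (hn : 2 ≤ finrank ℝ E) {z : E}
    (hric : ∀ u v, ricOf (riem Γ z) u v = ricOf (riem Γ z) v u)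
    (hW : weylOf (riem Γ z) = 0) (u v w : E) :
    riem Γ z u v w = symmSchouten Γ z v w • u - symmSchouten Γ z u w • v := by
  have hsch := schOf_riem_eq hn hric
  have h : weylOf (riem Γ z) u v w = 0 := by rw [hW]; rfl
  have hsymm : symmSchouten Γ z v u = symmSchouten Γ z u v := by
    rw [symmSchouten_apply, symmSchouten_apply, hric]
  simp only [weylOf, hsch, hsymm, sub_self, zero_smul, sub_zero] at h
  exact sub_eq_zero.1 h

/-- The Schouten tensor of a projectively Weyl-flat connection in dimension at least three
satisfies the Codazzi equation. This is the contracted second Bianchi identity. -/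
theorem cotton_eq_zero (hn : 3 ≤ finrank ℝ E) (hV : IsOpen V) (hΓ : ContDiffOn ℝ ∞ Γ V)
    (hs : ∀ z ∈ V, ∀ u v, Γ z u v = Γ z v u) {P : E → E →L[ℝ] E →L[ℝ] ℝ}
    (hP : ContDiffOn ℝ ∞ P V)
    (hR : ∀ z ∈ V, ∀ u v w, riem Γ z u v w = P z v w • u - P z u w • v)
    {z : E} (hz : z ∈ V) (t v w : E) :
    fderiv ℝ P z t v w + P z t (Γ z v w) = fderiv ℝ P z v t w + P z v (Γ z t w) := by
  have hVz := hV.mem_nhds hz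
  have hΓc := hΓ.contDiffAt hVz
  have hΓd := hΓc.differentiableAt (by simp)
  have hPd := (hP.contDiffAt hVz).differentiableAt (by simp)
  have hΓd2 : DifferentiableAt ℝ (fderiv ℝ Γ) z :=
    (hΓc.fderiv_right (m := 1) (by simp [one_add_one_eq_two, two_le_infty])).differentiableAt
      (by simp)
  have hsymm : ∀ a b x y, fderiv ℝ (fderiv ℝ Γ) z a b x y = fderiv ℝ (fderiv ℝ Γ) z b a x y :=
    fun a b x y ↦ congrArg (fun L : E →L[ℝ] E →L[ℝ] E ↦ L x y)
      ((hΓc.isSymmSndFDerivAt (by simp [two_le_infty])) a b)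
  have c : ∀ x : E, HasFDerivAt (fun _ : E ↦ x) (0 : E →L[ℝ] E) z := fun x ↦ hasFDerivAt_const x z
  -- The derivative of the identity `hR`.
  have hdR : ∀ a u v w : E,
      fderiv ℝ (fderiv ℝ Γ) z a u v w - fderiv ℝ (fderiv ℝ Γ) z a v u w
        + (fderiv ℝ Γ z a u (Γ z v w) + Γ z u (fderiv ℝ Γ z a v w))
        - (fderiv ℝ Γ z a v (Γ z u w) + Γ z v (fderiv ℝ Γ z a u w))
      = fderiv ℝ P z a v w • u - fderiv ℝ P z a u w • v := by
    intro a u v w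
    have h1 := ((((hΓd2.hasFDerivAt.clm_apply (c u)).clm_apply (c v)).clm_apply (c w)).sub
      (((hΓd2.hasFDerivAt.clm_apply (c v)).clm_apply (c u)).clm_apply (c w))).add
      ((hΓd.hasFDerivAt.clm_apply (c u)).clm_apply
        ((hΓd.hasFDerivAt.clm_apply (c v)).clm_apply (c w))) |>.sub
      ((hΓd.hasFDerivAt.clm_apply (c v)).clm_apply
        ((hΓd.hasFDerivAt.clm_apply (c u)).clm_apply (c w)))
    have h2 := (((hPd.hasFDerivAt.clm_apply (c v)).clm_apply (c w)).smul (c u)).sub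
      (((hPd.hasFDerivAt.clm_apply (c u)).clm_apply (c w)).smul (c v))
    have h3 : (fun y ↦ riem Γ y u v w) =ᶠ[𝓝 z] fun y ↦ P y v w • u - P y u w • v := by
      filter_upwards [hVz] with y hy using hR y hy u v w
    have h6 := h3.fderiv_eq (𝕜 := ℝ)
    simp only [riem_apply] at h6
    have h7 := h1.fderiv.symm.trans (h6.trans h2.fderiv)
    have := congrArg (fun L : E →L[ℝ] E ↦ L a) h7
    simp at this
    rw [← this]
    abel
  let C : E → E → E → ℝ := fun a b w ↦
    fderiv ℝ P z a b w + P z a (Γ z b w) - (fderiv ℝ P z b a w + P z b (Γ z a w))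
  have hanti : ∀ a b w, C a b w = -C b a w := fun a b w ↦ by simp only [C]; ring
  -- The second Bianchi identity.
  have hcyc : ∀ u : E, C t v w • u + C u t w • v + C v u w • t = 0 := by
    intro u
    have e1 := hdR t u v w
    have e2 := hdR u v t w
    have e3 := hdR v t u w
    have r := hR z hz
    have b : (fderiv ℝ P z t v w • u - fderiv ℝ P z t u w • v)
        + (fderiv ℝ P z u t w • v - fderiv ℝ P z u v w • t)
        + (fderiv ℝ P z v u w • t - fderiv ℝ P z v t w • u)
        + (Γ z t (riem Γ z u v w) - riem Γ z u v (Γ z t w))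
        + (Γ z u (riem Γ z v t w) - riem Γ z v t (Γ z u w))
        + (Γ z v (riem Γ z t u w) - riem Γ z t u (Γ z v w)) = 0 := by
      rw [← e1, ← e2, ← e3, hsymm u t v, hsymm v t u, hsymm v u t]
      simp only [riem_apply, map_add, map_sub]
      abel
    simp only [r, map_sub, map_smul] at b
    rw [hs z hz u t, hs z hz v t, hs z hz v u] at b
    simp only [C]
    rw [← b]
    module
  -- Contract with the free vector.
  have htrace : (finrank ℝ E : ℝ) * C t v w + C v t w + C v t w = 0 := by
    let c' : E → E →L[ℝ] ℝ := fun b ↦ ((fderiv ℝ P z).flip b).flip w + (P z).flip (Γ z b w)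
      - ((fderiv ℝ P z b).flip w + (P z b).comp ((Γ z).flip w))
    have hc' : ∀ a b, c' b a = C a b w := fun a b ↦ by simp [c', C]
    have : C t v w • LinearMap.id + (c' t : E →ₗ[ℝ] ℝ).smulRight v
        - (c' v : E →ₗ[ℝ] ℝ).smulRight t = 0 := by
      ext u
      simp only [LinearMap.sub_apply, LinearMap.add_apply, LinearMap.smul_apply, LinearMap.id_apply,
        LinearMap.smulRight_apply, ContinuousLinearMap.coe_coe, hc', LinearMap.zero_apply]
      rw [hanti u v w, ← hcyc u]
      module
    have := congrArg (LinearMap.trace ℝ E) this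
    rw [map_sub, map_add, map_smul, LinearMap.trace_id, LinearMap.trace_smulRight,
      LinearMap.trace_smulRight, map_zero] at this
    simp only [ContinuousLinearMap.coe_coe, hc', smul_eq_mul] at this
    rw [hanti t v w] at this ⊢
    linarith
  have hN : (3 : ℝ) ≤ finrank ℝ E := by exact_mod_cast hn
  rw [hanti v t w] at htrace
  have : ((finrank ℝ E : ℝ) - 2) * C t v w = 0 := by linarith
  have := (mul_eq_zero.1 this).resolve_left (by linarith)
  exact sub_eq_zero.1 this

/-- The connection form, with values in the endomorphisms of `G × Hom(E, G)`, of the (flat)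
projective tractor system `∇σ = μ`, `∇μ = -P ⊗ σ`. -/
def tractorForm (G : Type*) [NormedAddCommGroup G] [NormedSpace ℝ G] [FiniteDimensional ℝ G]
    (Γ : E →L[ℝ] E →L[ℝ] E) (P : E →L[ℝ] E →L[ℝ] ℝ) :
    E →L[ℝ] (G × (E →L[ℝ] G)) →L[ℝ] (G × (E →L[ℝ] G)) :=
  (LinearMap.mk₂ ℝ (fun u (p : G × (E →L[ℝ] G)) ↦
    (p.2 u, p.2.comp (Γ u) - (P u).smulRight p.1))
    (by
      intros
      refine Prod.ext (by simp) ?_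
      ext
      simp
      module)
    (by
      intros
      refine Prod.ext (by simp) ?_
      ext
      simp
      module)
    (by
      intros
      refine Prod.ext (by simp) ?_
      ext
      simp
      module)
    (by
      intros
      refine Prod.ext (by simp) ?_
      ext
      simp
      module)).toContinuousBilinearMap

theorem tractorForm_apply (G : Type*) [NormedAddCommGroup G] [NormedSpace ℝ G]
    [FiniteDimensional ℝ G] (Γ : E →L[ℝ] E →L[ℝ] E) (P : E →L[ℝ] E →L[ℝ] ℝ) (u : E)
    (p : G × (E →L[ℝ] G)) :
    tractorForm G Γ P u p = (p.2 u, p.2.comp (Γ u) - (P u).smulRight p.1) := rfl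

end ProjectiveFlatness

/-! ### Parallel tractors and parallel coframes -/

section ParallelCoframe

variable {E : Type*} [NormedAddCommGroup E] [NormedSpace ℝ E] [FiniteDimensional ℝ E]
  {Γ : E → E →L[ℝ] E →L[ℝ] E} {V : Set E}

/-- If the projective Weyl and Cotton tensors vanish, then the tractor system `∇σ = μ`,
`∇μ = -P ⊗ σ` is integrable, and has local solutions with arbitrary initial values. -/
theorem exists_parallel_tractor {G : Type*} [NormedAddCommGroup G] [NormedSpace ℝ G]
    [FiniteDimensional ℝ G] (hV : IsOpen V) (hΓ : ContDiffOn ℝ ∞ Γ V)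
    (hs : ∀ z ∈ V, ∀ u v, Γ z u v = Γ z v u) {P : E → E →L[ℝ] E →L[ℝ] ℝ}
    (hP : ContDiffOn ℝ ∞ P V) (hPs : ∀ z ∈ V, ∀ u v, P z u v = P z v u)
    (hR : ∀ z ∈ V, ∀ u v w, riem Γ z u v w = P z v w • u - P z u w • v)
    (hC : ∀ z ∈ V, ∀ t v w,
      fderiv ℝ P z t v w + P z t (Γ z v w) = fderiv ℝ P z v t w + P z v (Γ z t w))
    {z₀ : E} (hz₀ : z₀ ∈ V) (σ₀ : G) (μ₀ : E →L[ℝ] G) :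
    ∃ W ⊆ V, IsOpen W ∧ z₀ ∈ W ∧ ∃ (σ : E → G) (μ : E → E →L[ℝ] G), σ z₀ = σ₀ ∧ μ z₀ = μ₀ ∧
      ContDiffOn ℝ ∞ σ W ∧ ContDiffOn ℝ ∞ μ W ∧ (∀ z ∈ W, HasFDerivAt σ (μ z) z) ∧
      ∀ z ∈ W, ∀ u v, fderiv ℝ μ z u v = μ z (Γ z u v) - P z u v • σ z := by
  have hA : ContDiffOn ℝ ∞ (fun z ↦ tractorForm G (Γ z) (P z)) V := by
    rw [contDiffOn_clm_apply]
    intro u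
    rw [contDiffOn_clm_apply]
    intro p
    simp only [tractorForm_apply]
    have hu : ContDiffOn ℝ ∞ (fun _ : E ↦ u) V := contDiffOn_const
    refine contDiffOn_const.prodMk ((contDiffOn_const.clm_comp (hΓ.clm_apply hu)).sub ?_)
    rw [contDiffOn_clm_apply]
    intro w
    exact ((hP.clm_apply hu).clm_apply contDiffOn_const).smul contDiffOn_const
  obtain ⟨W, hWV, hWo, hzW, f, hf0, hfs, hf⟩ := exists_contDiffOn_of_integrable
    (A := fun z ↦ tractorForm G (Γ z) (P z)) hV hz₀ hA (by
      intro z hz u v a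
      have hVz := hV.mem_nhds hz
      have hΓd := (hΓ.contDiffAt hVz).differentiableAt (by simp)
      have hPd := (hP.contDiffAt hVz).differentiableAt (by simp)
      have hAd := (hA.contDiffAt hVz).differentiableAt (by simp)
      have hfst : ∀ u v, (fderiv ℝ (fun z ↦ tractorForm G (Γ z) (P z)) z u v a).1 = 0 := by
        intro u v
        rw [← fderiv_apply_apply hAd]
        have h1 : HasFDerivAt (fun y ↦ tractorForm G (Γ y) (P y) v a) _ z :=
          ((hAd.hasFDerivAt.clm_apply (hasFDerivAt_const v z)).clm_apply
            (hasFDerivAt_const a z))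
        have h2 := (ContinuousLinearMap.fst ℝ G (E →L[ℝ] G)).hasFDerivAt.comp z
          h1.differentiableAt.hasFDerivAt
        have h3 : HasFDerivAt (fun y ↦ (tractorForm G (Γ y) (P y) v a).1) (0 : E →L[ℝ] G) z :=
          hasFDerivAt_const (a.2 v) z
        have := h2.unique h3
        exact congrArg (fun L : E →L[ℝ] G ↦ L u) this
      have hsnd : ∀ u v w, (fderiv ℝ (fun z ↦ tractorForm G (Γ z) (P z)) z u v a).2 w =
          a.2 (fderiv ℝ Γ z u v w) - fderiv ℝ P z u v w • a.1 := by
        intro u v w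
        rw [← fderiv_apply_apply hAd]
        have h1 : HasFDerivAt (fun y ↦ tractorForm G (Γ y) (P y) v a) _ z :=
          ((hAd.hasFDerivAt.clm_apply (hasFDerivAt_const v z)).clm_apply
            (hasFDerivAt_const a z))
        have h2 := ((ContinuousLinearMap.apply ℝ G w).comp
          (ContinuousLinearMap.snd ℝ G (E →L[ℝ] G))).hasFDerivAt.comp z
          h1.differentiableAt.hasFDerivAt
        have h3 := (a.2.hasFDerivAt.comp z
          ((hΓd.hasFDerivAt.clm_apply (hasFDerivAt_const v z)).clm_apply
            (hasFDerivAt_const w z))).sub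
          (((hPd.hasFDerivAt.clm_apply (hasFDerivAt_const v z)).clm_apply
            (hasFDerivAt_const w z)).smul (hasFDerivAt_const a.1 z))
        have := congrArg (fun L : E →L[ℝ] G ↦ L u) (h2.unique h3)
        simpa using this
      refine Prod.ext ?_ ?_
      · simp only [Prod.fst_add, hfst, tractorForm_apply]
        simp [hs z hz u v, hPs z hz u v]
      · ext w
        have r := congrArg a.2 (hR z hz u v w)
        have c := hC z hz u v w
        simp only [riem_apply, map_add, map_sub, map_smul] at r
        simp only [Prod.snd_add, add_apply, hsnd, tractorForm_apply, sub_apply,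
          ContinuousLinearMap.comp_apply, ContinuousLinearMap.smulRight_apply]
        rw [← sub_eq_zero] at r ⊢
        have c' : fderiv ℝ P z u v w = fderiv ℝ P z v u w + P z v (Γ z u w) - P z u (Γ z v w) :=
          eq_sub_of_add_eq c
        rw [← r, c']
        module) (σ₀, μ₀)
  refine ⟨W, hWV, hWo, hzW, fun z ↦ (f z).1, fun z ↦ (f z).2, by simp [hf0], by simp [hf0],
    hfs.fst, hfs.snd, ?_, ?_⟩
  · intro z hz
    refine ((ContinuousLinearMap.fst ℝ G (E →L[ℝ] G)).hasFDerivAt.comp z (hf z hz)).congr_fderiv ?_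
    ext u
    simp [tractorForm_apply]
  · intro z hz u v
    have := ((ContinuousLinearMap.snd ℝ G (E →L[ℝ] G)).hasFDerivAt.comp z (hf z hz)).fderiv
    simp only [Function.comp_def, ContinuousLinearMap.coe_snd'] at this
    rw [this]
    simp [tractorForm_apply]

/-- A solution `(s, y)` of the tractor system with values in `ℝ × E` and initial values `(1, 0)`,
with the identity as derivative of `y`, provides the affine coordinates `y / s`. Their
differential is parallel for the projective change by `-ds / s`. -/
theorem exists_parallel_coframe_of_tracefree (hn : 3 ≤ finrank ℝ E) (hV : IsOpen V)
    (hΓ : ContDiffOn ℝ ∞ Γ V) (hs : ∀ z ∈ V, ∀ u v, Γ z u v = Γ z v u)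
    (htr : ∀ z ∈ V, ∀ u, traceL E (Γ z u) = 0) (hW : ∀ z ∈ V, weylOf (riem Γ z) = 0)
    {z₀ : E} (hz₀ : z₀ ∈ V) :
    ∃ W ⊆ V, IsOpen W ∧ z₀ ∈ W ∧ ∃ (Υ : E → E →L[ℝ] ℝ) (θ : E → E →L[ℝ] E),
      ContDiffOn ℝ ∞ Υ W ∧ ContDiffOn ℝ ∞ θ W ∧ (∀ z ∈ W, Function.Injective (θ z)) ∧
      ∀ z ∈ W, ∀ u v, fderiv ℝ θ z u v = θ z (Γ z u v + projTerm (Υ z) u v) := by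
  have hric : ∀ z ∈ V, ∀ u v, ricOf (riem Γ z) u v = ricOf (riem Γ z) v u :=
    fun z hz u v ↦ ricOf_riem_symm hV hΓ hs htr hz u v
  have hP := contDiffOn_symmSchouten hV hΓ
  have hR : ∀ z ∈ V, ∀ u v w,
      riem Γ z u v w = symmSchouten Γ z v w • u - symmSchouten Γ z u w • v := fun z hz ↦
    riem_eq_of_weylOf_eq_zero (by omega) (hric z hz) (hW z hz)
  obtain ⟨W, hWV, hWo, hzW, σ, μ, hσ0, hμ0, hσs, hμs, hσ, hμ⟩ := exists_parallel_tractor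
    (G := ℝ × E) hV hΓ hs hP
    (fun z hz u v ↦ by rw [symmSchouten_apply, symmSchouten_apply, hric z hz]) hR
    (fun z hz ↦ cotton_eq_zero hn hV hΓ hs hP hR hz) hz₀ (1, 0)
    (ContinuousLinearMap.inr ℝ ℝ E)
  let s : E → ℝ := fun z ↦ (σ z).1
  let y : E → E := fun z ↦ (σ z).2
  let m : E → E →L[ℝ] ℝ := fun z ↦ (ContinuousLinearMap.fst ℝ ℝ E).comp (μ z)
  let η : E → E →L[ℝ] E := fun z ↦ (ContinuousLinearMap.snd ℝ ℝ E).comp (μ z)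
  -- The differential of the affine coordinates `y / s`.
  let θ : E → E →L[ℝ] E := fun z ↦ (s z)⁻¹ • η z - ((s z)⁻¹ ^ 2) • (m z).smulRight (y z)
  have hss : ContDiffOn ℝ ∞ s W := hσs.fst
  have hys : ContDiffOn ℝ ∞ y W := hσs.snd
  have hms : ContDiffOn ℝ ∞ m W := contDiffOn_const.clm_comp hμs
  have hηs : ContDiffOn ℝ ∞ η W := contDiffOn_const.clm_comp hμs
  let W₁ := W ∩ s ⁻¹' {0}ᶜ
  have hW₁ : IsOpen W₁ := hss.continuousOn.isOpen_inter_preimage hWo isOpen_compl_singleton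
  have hWW₁ : W₁ ⊆ W := inter_subset_left
  have hsi : ContDiffOn ℝ ∞ (fun z ↦ (s z)⁻¹) W₁ := (hss.mono hWW₁).inv fun z hz ↦ hz.2
  have hθs : ContDiffOn ℝ ∞ θ W₁ := by
    refine (hsi.smul (hηs.mono hWW₁)).sub ((hsi.pow 2).smul ?_)
    rw [contDiffOn_clm_apply]
    intro w
    exact ((hms.mono hWW₁).clm_apply contDiffOn_const).smul (hys.mono hWW₁)
  -- The coframe is invertible at `z₀`, hence nearby.
  let W₂ := W₁ ∩ θ ⁻¹' {f | IsUnit f}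
  have hW₂ : IsOpen W₂ := hθs.continuousOn.isOpen_inter_preimage hW₁ Units.isOpen
  have hWW₂ : W₂ ⊆ W₁ := inter_subset_left
  have hz1 : z₀ ∈ W₁ := ⟨hzW, by simp [s, hσ0]⟩
  refine ⟨W₂, hWW₂.trans (hWW₁.trans hWV), hW₂, ⟨hz1, ?_⟩, fun z ↦ -(s z)⁻¹ • m z, θ,
    (hsi.neg.smul (hms.mono hWW₁)).mono hWW₂, hθs.mono hWW₂, ?_, ?_⟩
  · have : θ z₀ = 1 := by
      ext1 w
      simp [θ, s, η, m, y, hσ0, hμ0]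
    simp [this]
  · rintro z ⟨_, hu⟩
    obtain ⟨e, he⟩ := hu
    refine Function.LeftInverse.injective (g := ((e⁻¹ : (E →L[ℝ] E)ˣ) : E →L[ℝ] E)) fun x ↦ ?_
    have h1 : ((e⁻¹ : (E →L[ℝ] E)ˣ) : E →L[ℝ] E) * e = 1 := e.inv_mul
    rw [← he]
    exact congrArg (fun f : E →L[ℝ] E ↦ f x) h1
  · intro z hz u v
    have hzW1 : z ∈ W₁ := hWW₂ hz
    have hzW : z ∈ W := hWW₁ hzW1
    have hsz : s z ≠ 0 := hzW1.2
    have ds : HasFDerivAt s (m z) z :=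
      (ContinuousLinearMap.fst ℝ ℝ E).hasFDerivAt.comp z (hσ z hzW)
    have dy : HasFDerivAt y (η z) z :=
      (ContinuousLinearMap.snd ℝ ℝ E).hasFDerivAt.comp z (hσ z hzW)
    have dμ : HasFDerivAt μ (fderiv ℝ μ z) z :=
      ((hμs.contDiffAt (hWo.mem_nhds hzW)).differentiableAt (by simp)).hasFDerivAt
    have dμv := dμ.clm_apply (hasFDerivAt_const v z)
    have dm : HasFDerivAt (fun z ↦ m z v) _ z :=
      (ContinuousLinearMap.fst ℝ ℝ E).hasFDerivAt.comp z dμv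
    have dη : HasFDerivAt (fun z ↦ η z v) _ z :=
      (ContinuousLinearMap.snd ℝ ℝ E).hasFDerivAt.comp z dμv
    have di := (hasDerivAt_inv hsz).comp_hasFDerivAt z ds
    have dθ := (di.smul dη).sub ((di.pow 2).smul (dm.smul dy))
    have h1 : fderiv ℝ θ z u v = fderiv ℝ (fun z ↦ θ z v) z u := by
      have hd := ((hθs.contDiffAt (hW₁.mem_nhds hzW1)).differentiableAt (by simp)).hasFDerivAt
      rw [(hd.clm_apply (hasFDerivAt_const v z)).fderiv]
      simp
    have h2 : HasFDerivAt (fun z ↦ θ z v) _ z := dθ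
    have hμm : m z (Γ z u v) - symmSchouten Γ z u v * s z = (fderiv ℝ μ z u v).1 := by
      rw [hμ z hzW]
      rfl
    have hμη : η z (Γ z u v) - symmSchouten Γ z u v • y z = (fderiv ℝ μ z u v).2 := by
      rw [hμ z hzW]
      rfl
    rw [h1, h2.fderiv]
    simp [projTerm_apply, θ, ← hμm, ← hμη]
    match_scalars <;> field_simp <;> ring

/-- Christoffel symbols with vanishing projective Weyl tensor in dimension at least three locally
admit a projective change with a parallel coframe. -/
theorem exists_parallel_coframe (hn : 3 ≤ finrank ℝ E) (hV : IsOpen V)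
    (hΓ : ContDiffOn ℝ ∞ Γ V) (hs : ∀ z ∈ V, ∀ u v, Γ z u v = Γ z v u)
    (hW : ∀ z ∈ V, weylOf (riem Γ z) = 0) {z₀ : E} (hz₀ : z₀ ∈ V) :
    ∃ W ⊆ V, IsOpen W ∧ z₀ ∈ W ∧ ∃ (Υ : E → E →L[ℝ] ℝ) (θ : E → E →L[ℝ] E),
      ContDiffOn ℝ ∞ Υ W ∧ ContDiffOn ℝ ∞ θ W ∧ (∀ z ∈ W, Function.Injective (θ z)) ∧
      ∀ z ∈ W, ∀ u v, fderiv ℝ θ z u v = θ z (Γ z u v + projTerm (Υ z) u v) := by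
  -- Normalize the Christoffel symbol to be trace-free.
  let Υ₀ : E → E →L[ℝ] ℝ := fun z ↦ -((finrank ℝ E : ℝ) + 1)⁻¹ • (traceL E).comp (Γ z)
  have hΥ₀ : ContDiffOn ℝ ∞ Υ₀ V :=
    (contDiffOn_const (c := -((finrank ℝ E : ℝ) + 1)⁻¹)).smul
      ((contDiffOn_const (c := traceL E)).clm_comp hΓ)
  have hN : (finrank ℝ E : ℝ) + 1 ≠ 0 := by positivity
  obtain ⟨W, hWV, hWo, hzW, Υ, θ, hΥ, hθ, hinj, hp⟩ := exists_parallel_coframe_of_tracefree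
    (Γ := fun z ↦ Γ z + projTerm (Υ₀ z)) hn hV (contDiffOn_add_projTerm hΓ hΥ₀)
    (fun z hz u v ↦ by
      simp only [add_apply, projTerm_apply, hs z hz u v]
      abel)
    (fun z hz u ↦ by
      rw [add_apply, map_add, traceL_projTerm]
      simp only [Υ₀, smul_apply, ContinuousLinearMap.comp_apply, smul_eq_mul]
      field_simp
      ring)
    (fun z hz ↦ by
      have hVz := hV.mem_nhds hz
      rw [weylOf_riem_add_projTerm (by omega) ((hΓ.contDiffAt hVz).differentiableAt (by simp))
        ((hΥ₀.contDiffAt hVz).differentiableAt (by simp)) (hs z hz), hW z hz]) hz₀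
  refine ⟨W, hWV, hWo, hzW, fun z ↦ Υ₀ z + Υ z, θ, (hΥ₀.mono hWV).add hΥ, hθ, hinj, ?_⟩
  intro z hz u v
  rw [hp z hz, map_add projTerm]
  simp only [add_apply, add_assoc]

end ParallelCoframe

/-! ### The chart at a point -/

theorem mlieBracket_eq_lieBracket_of_eventuallyEq {E : Type*} [NormedAddCommGroup E]
    [NormedSpace ℝ E] {V W V' W' : E → E} {z : E} (hV : V =ᶠ[𝓝 z] V') (hW : W =ᶠ[𝓝 z] W') :
    VectorField.mlieBracket 𝓘(ℝ, E) V W z = VectorField.lieBracket ℝ V' W' z := by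
  have h := congrFun (VectorField.mlieBracketWithin_eq_lieBracketWithin (𝕜 := ℝ)
    (V := V) (W := W) (s := univ)) z
  rw [VectorField.lieBracketWithin_univ] at h
  have h' := Filter.EventuallyEq.lieBracket_vectorField_eq (𝕜 := ℝ) hV hW
  exact (congrFun VectorField.mlieBracketWithin_univ z).symm.trans (h.trans h')

section Chart

variable {n : ℕ} {M : Type*} [TopologicalSpace M] [ChartedSpace (EuclideanSpace ℝ (Fin n)) M]

local notation "𝔼" => EuclideanSpace ℝ (Fin n)

variable {x₀ y : M}

theorem extChartAt_source_mem_nhds_of_mem (hy : y ∈ (extChartAt (𝓡 n) x₀).source) :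
    (extChartAt (𝓡 n) x₀).source ∈ 𝓝 y :=
  (isOpen_extChartAt_source x₀).mem_nhds hy

theorem extChartAt_target_mem_nhds_of_mem (hy : y ∈ (extChartAt (𝓡 n) x₀).source) :
    (extChartAt (𝓡 n) x₀).target ∈ 𝓝 (extChartAt (𝓡 n) x₀ y) :=
  (isOpen_extChartAt_target x₀).mem_nhds ((extChartAt (𝓡 n) x₀).map_source hy)

variable [IsManifold (𝓡 n) ∞ M]

/-- The components of a tangent vector at `y` in the chart at `x₀`, i.e. the derivative at `y` of
that chart. -/
def toCoord (x₀ y : M) : TangentSpace (𝓡 n) y →L[ℝ] 𝔼 :=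
  (trivializationAt 𝔼 (TangentSpace (𝓡 n)) x₀).continuousLinearMapAt ℝ y

/-- The tangent vector at `y` with given components in the chart at `x₀`. -/
def ofCoord (x₀ y : M) : 𝔼 →L[ℝ] TangentSpace (𝓡 n) y :=
  (trivializationAt 𝔼 (TangentSpace (𝓡 n)) x₀).symmL ℝ y

/-- The vector field `Y` in the chart at `x₀`. -/
def inChart (x₀ : M) (Y : VField n M) (z : 𝔼) : 𝔼 :=
  toCoord x₀ ((extChartAt (𝓡 n) x₀).symm z) (Y ((extChartAt (𝓡 n) x₀).symm z))

theorem mem_baseSet (hy : y ∈ (extChartAt (𝓡 n) x₀).source) :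
    y ∈ (trivializationAt 𝔼 (TangentSpace (𝓡 n)) x₀).baseSet := by
  simpa [TangentBundle.trivializationAt_baseSet] using hy

theorem ofCoord_toCoord (hy : y ∈ (extChartAt (𝓡 n) x₀).source) (v : TangentSpace (𝓡 n) y) :
    ofCoord x₀ y (toCoord x₀ y v) = v :=
  Trivialization.symmL_continuousLinearMapAt _ (mem_baseSet hy) v

theorem toCoord_ofCoord (hy : y ∈ (extChartAt (𝓡 n) x₀).source) (c : 𝔼) :
    toCoord x₀ y (ofCoord x₀ y c) = c :=
  Trivialization.continuousLinearMapAt_symmL _ (mem_baseSet hy) c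

theorem toCoord_injective (hy : y ∈ (extChartAt (𝓡 n) x₀).source) {v w : TangentSpace (𝓡 n) y}
    (h : toCoord x₀ y v = toCoord x₀ y w) : v = w := by
  rw [← ofCoord_toCoord hy v, h, ofCoord_toCoord hy]

theorem mfderiv_extChartAt_eq (hy : y ∈ (extChartAt (𝓡 n) x₀).source) :
    mfderiv (𝓡 n) 𝓘(ℝ, 𝔼) (extChartAt (𝓡 n) x₀) y = toCoord x₀ y :=
  (TangentBundle.continuousLinearMapAt_trivializationAt (by simpa using hy)).symm

theorem mfderiv_extChartAt_symm_eq (hy : y ∈ (extChartAt (𝓡 n) x₀).source) :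
    mfderiv 𝓘(ℝ, 𝔼) (𝓡 n) (extChartAt (𝓡 n) x₀).symm (extChartAt (𝓡 n) x₀ y) =
      ofCoord x₀ y := by
  have h := TangentBundle.symmL_trivializationAt (I := 𝓡 n) (x₀ := x₀) (x := y) (by simpa using hy)
  rw [ModelWithCorners.range_eq_univ, mfderivWithin_univ] at h
  exact h.symm

theorem snd_trivializationAt (hy : y ∈ (extChartAt (𝓡 n) x₀).source) (v : TangentSpace (𝓡 n) y) :
    (trivializationAt 𝔼 (TangentSpace (𝓡 n)) x₀ ⟨y, v⟩).2 = toCoord x₀ y v := by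
  rw [toCoord, Trivialization.continuousLinearMapAt_apply,
    Trivialization.coe_linearMapAt_of_mem _ (mem_baseSet hy)]

theorem contMDiffAt_extChartAt_symm_apply (hy : y ∈ (extChartAt (𝓡 n) x₀).source) :
    ContMDiffAt 𝓘(ℝ, 𝔼) (𝓡 n) ∞ (extChartAt (𝓡 n) x₀).symm (extChartAt (𝓡 n) x₀ y) :=
  (contMDiffOn_extChartAt_symm x₀).contMDiffAt (extChartAt_target_mem_nhds_of_mem hy)

section

variable {F : Type*} [NormedAddCommGroup F] [NormedSpace ℝ F]

theorem contMDiffAt_iff_contDiffAt_chart (hy : y ∈ (extChartAt (𝓡 n) x₀).source) {f : M → F} :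
    ContMDiffAt (𝓡 n) 𝓘(ℝ, F) ∞ f y ↔
      ContDiffAt ℝ ∞ (fun z ↦ f ((extChartAt (𝓡 n) x₀).symm z)) (extChartAt (𝓡 n) x₀ y) := by
  rw [← contMDiffAt_iff_contDiffAt]
  refine ⟨fun h ↦ ?_, fun h ↦ ?_⟩
  · refine ContMDiffAt.comp (I' := 𝓡 n) (extChartAt (𝓡 n) x₀ y) ?_
      (contMDiffAt_extChartAt_symm_apply hy)
    rwa [(extChartAt (𝓡 n) x₀).left_inv hy]
  · refine (ContMDiffAt.comp y h
      (contMDiffAt_extChartAt' (by simpa using hy))).congr_of_eventuallyEq ?_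
    filter_upwards [extChartAt_source_mem_nhds_of_mem hy] with x hx
    exact congrArg f ((extChartAt (𝓡 n) x₀).left_inv hx).symm

theorem mdifferentiableAt_iff_differentiableAt_chart (hy : y ∈ (extChartAt (𝓡 n) x₀).source)
    {f : M → F} :
    MDifferentiableAt (𝓡 n) 𝓘(ℝ, F) f y ↔
      DifferentiableAt ℝ (fun z ↦ f ((extChartAt (𝓡 n) x₀).symm z)) (extChartAt (𝓡 n) x₀ y) := by
  rw [← mdifferentiableAt_iff_differentiableAt]
  refine ⟨fun h ↦ ?_, fun h ↦ ?_⟩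
  · refine MDifferentiableAt.comp (I' := 𝓡 n) (extChartAt (𝓡 n) x₀ y) ?_
      ((contMDiffAt_extChartAt_symm_apply hy).mdifferentiableAt (by simp))
    rwa [(extChartAt (𝓡 n) x₀).left_inv hy]
  · refine (MDifferentiableAt.comp y h
      (mdifferentiableAt_extChartAt (by simpa using hy))).congr_of_eventuallyEq ?_
    filter_upwards [extChartAt_source_mem_nhds_of_mem hy] with x hx
    exact congrArg f ((extChartAt (𝓡 n) x₀).left_inv hx).symm

theorem mvfderiv_eq_fderiv_chart (hy : y ∈ (extChartAt (𝓡 n) x₀).source) {f : M → F}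
    (hf : MDifferentiableAt (𝓡 n) 𝓘(ℝ, F) f y) (v : TangentSpace (𝓡 n) y) :
    mvfderiv (𝓡 n) f y v =
      fderiv ℝ (fun z ↦ f ((extChartAt (𝓡 n) x₀).symm z)) (extChartAt (𝓡 n) x₀ y)
        (toCoord x₀ y v) := by
  have h1 := (mdifferentiableAt_iff_differentiableAt_chart hy).1 hf
  have h2 : mfderiv (𝓡 n) 𝓘(ℝ, F)
      ((fun z ↦ f ((extChartAt (𝓡 n) x₀).symm z)) ∘ extChartAt (𝓡 n) x₀) y =
        (mfderiv 𝓘(ℝ, 𝔼) 𝓘(ℝ, F) (fun z ↦ f ((extChartAt (𝓡 n) x₀).symm z))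
          (extChartAt (𝓡 n) x₀ y)).comp (mfderiv (𝓡 n) 𝓘(ℝ, 𝔼) (extChartAt (𝓡 n) x₀) y) :=
    mfderiv_comp y h1.mdifferentiableAt (mdifferentiableAt_extChartAt (by simpa using hy))
  have h3 : mfderiv (𝓡 n) 𝓘(ℝ, F)
      ((fun z ↦ f ((extChartAt (𝓡 n) x₀).symm z)) ∘ extChartAt (𝓡 n) x₀) y =
      mfderiv (𝓡 n) 𝓘(ℝ, F) f y := by
    apply Filter.EventuallyEq.mfderiv_eq
    filter_upwards [extChartAt_source_mem_nhds_of_mem hy] with x hx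
    exact congrArg f ((extChartAt (𝓡 n) x₀).left_inv hx)
  rw [mfderiv_eq_fderiv, mfderiv_extChartAt_eq hy, h3] at h2
  exact DFunLike.congr_fun h2 v

end

theorem diffAt_iff_inChart (hy : y ∈ (extChartAt (𝓡 n) x₀).source) {Y : VField n M} :
    DiffAt Y y ↔ DifferentiableAt ℝ (inChart x₀ Y) (extChartAt (𝓡 n) x₀ y) := by
  have h : (fun x ↦ (trivializationAt 𝔼 (TangentSpace (𝓡 n)) x₀ ⟨x, Y x⟩).2) =ᶠ[𝓝 y]
      fun x ↦ toCoord x₀ x (Y x) := by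
    filter_upwards [extChartAt_source_mem_nhds_of_mem hy] with x hx
    exact snd_trivializationAt hx _
  rw [DiffAt, Trivialization.mdifferentiableAt_section_iff _
    (trivializationAt 𝔼 (TangentSpace (𝓡 n)) x₀) Y (mem_baseSet hy), h.mdifferentiableAt_iff]
  exact mdifferentiableAt_iff_differentiableAt_chart hy

/-- The vector field `Y` is smooth at `x`. -/
def SmoothAt (Y : VField n M) (x : M) : Prop :=
  ContMDiffAt (𝓡 n) ((𝓡 n).prod 𝓘(ℝ, 𝔼)) ∞ (fun y ↦ TotalSpace.mk' 𝔼 y (Y y)) x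

theorem SmoothAt.diffAt {Y : VField n M} (h : SmoothAt Y y) : DiffAt Y y :=
  ContMDiffAt.mdifferentiableAt h (by simp)

theorem smoothAt_iff_inChart (hy : y ∈ (extChartAt (𝓡 n) x₀).source) {Y : VField n M} :
    SmoothAt Y y ↔ ContDiffAt ℝ ∞ (inChart x₀ Y) (extChartAt (𝓡 n) x₀ y) := by
  have h : (fun x ↦ (trivializationAt 𝔼 (TangentSpace (𝓡 n)) x₀ ⟨x, Y x⟩).2) =ᶠ[𝓝 y]
      fun x ↦ toCoord x₀ x (Y x) := by
    filter_upwards [extChartAt_source_mem_nhds_of_mem hy] with x hx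
    exact snd_trivializationAt hx _
  rw [SmoothAt, Trivialization.contMDiffAt_section_iff
    (trivializationAt 𝔼 (TangentSpace (𝓡 n)) x₀) (mem_baseSet hy), h.contMDiffAt_iff]
  exact contMDiffAt_iff_contDiffAt_chart hy

theorem inChart_extChartAt (hy : y ∈ (extChartAt (𝓡 n) x₀).source) (Y : VField n M) :
    inChart x₀ Y (extChartAt (𝓡 n) x₀ y) = toCoord x₀ y (Y y) := by
  rw [inChart, (extChartAt (𝓡 n) x₀).left_inv hy]

/-- The Lie bracket in a chart. -/
theorem toCoord_mlieBracket (hy : y ∈ (extChartAt (𝓡 n) x₀).source) {X Y : VField n M}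
    (hX : DiffAt X y) (hY : DiffAt Y y) :
    toCoord x₀ y (VectorField.mlieBracket (𝓡 n) X Y y) =
      VectorField.lieBracket ℝ (inChart x₀ X) (inChart x₀ Y) (extChartAt (𝓡 n) x₀ y) := by
  have hpull : ∀ V : VField n M, ∀ z ∈ (extChartAt (𝓡 n) x₀).target,
      VectorField.mpullback 𝓘(ℝ, 𝔼) (𝓡 n) (extChartAt (𝓡 n) x₀).symm V z = inChart x₀ V z := by
    intro V z hz
    have hs := (extChartAt (𝓡 n) x₀).map_target hz
    have h1 := mfderiv_extChartAt_symm_eq hs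
    rw [(extChartAt (𝓡 n) x₀).right_inv hz] at h1
    have h2 : (mfderiv 𝓘(ℝ, 𝔼) (𝓡 n) (extChartAt (𝓡 n) x₀).symm z).inverse =
        toCoord x₀ ((extChartAt (𝓡 n) x₀).symm z) := by
      rw [h1]
      exact ContinuousLinearMap.inverse_eq (by ext c : 1; exact ofCoord_toCoord hs c)
        (by ext c : 1; exact toCoord_ofCoord hs c)
    rw [VectorField.mpullback_apply, h2]
    rfl
  have hz := (extChartAt (𝓡 n) x₀).map_source hy
  have hX' : DiffAt X ((extChartAt (𝓡 n) x₀).symm (extChartAt (𝓡 n) x₀ y)) := by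
    rwa [(extChartAt (𝓡 n) x₀).left_inv hy]
  have hY' : DiffAt Y ((extChartAt (𝓡 n) x₀).symm (extChartAt (𝓡 n) x₀ y)) := by
    rwa [(extChartAt (𝓡 n) x₀).left_inv hy]
  have : IsManifold (𝓡 n) (minSmoothness ℝ 2) M := by
    rw [minSmoothness_of_isRCLikeNormedField]
    exact IsManifold.of_le two_le_infty
  have key := VectorField.mpullback_mlieBracket hX' hY' (contMDiffAt_extChartAt_symm_apply hy)
    (by simpa using two_le_infty)
  rw [hpull _ _ hz, inChart_extChartAt hy] at key
  rw [key]
  have he : ∀ V : VField n M, VectorField.mpullback 𝓘(ℝ, 𝔼) (𝓡 n) (extChartAt (𝓡 n) x₀).symm V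
      =ᶠ[𝓝 (extChartAt (𝓡 n) x₀ y)] inChart x₀ V := fun V ↦ by
    filter_upwards [extChartAt_target_mem_nhds_of_mem hy] with z hz using hpull V z hz
  exact mlieBracket_eq_lieBracket_of_eventuallyEq (he X) (he Y)

end Chart

/-! ### Tensor fields and Christoffel symbols in a chart -/

section ChartTensors

variable {n : ℕ} {M : Type*} [TopologicalSpace M] [ChartedSpace (EuclideanSpace ℝ (Fin n)) M]
  [IsManifold (𝓡 n) ∞ M] {x₀ y : M}

local notation "𝔼" => EuclideanSpace ℝ (Fin n)

/-- The components of an endomorphism of the tangent space at `x` in the chart at `x₀`. -/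
def endoCoord (x₀ x : M) (A : TangentSpace (𝓡 n) x →L[ℝ] TangentSpace (𝓡 n) x) : 𝔼 →L[ℝ] 𝔼 :=
  (toCoord x₀ x).comp (A.comp (ofCoord x₀ x))

/-- The components of a covector at `x` in the chart at `x₀`. -/
def covCoord (x₀ x : M) (υ : TangentSpace (𝓡 n) x →L[ℝ] ℝ) : 𝔼 →L[ℝ] ℝ :=
  υ.comp (ofCoord x₀ x)

/-- The components of a bilinear form on the tangent space at `x` in the chart at `x₀`. -/
def bilinCoord (x₀ x : M) (b : TangentSpace (𝓡 n) x →L[ℝ] TangentSpace (𝓡 n) x →L[ℝ] ℝ) :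
    𝔼 →L[ℝ] 𝔼 →L[ℝ] ℝ :=
  ((ofCoord x₀ x).precomp ℝ).comp (b.comp (ofCoord x₀ x))

theorem endoCoord_toCoord (hy : y ∈ (extChartAt (𝓡 n) x₀).source)
    (A : TangentSpace (𝓡 n) y →L[ℝ] TangentSpace (𝓡 n) y) (v : TangentSpace (𝓡 n) y) :
    endoCoord x₀ y A (toCoord x₀ y v) = toCoord x₀ y (A v) :=
  congrArg (fun w ↦ toCoord x₀ y (A w)) (ofCoord_toCoord hy v)

theorem covCoord_toCoord (hy : y ∈ (extChartAt (𝓡 n) x₀).source)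
    (υ : TangentSpace (𝓡 n) y →L[ℝ] ℝ) (v : TangentSpace (𝓡 n) y) :
    covCoord x₀ y υ (toCoord x₀ y v) = υ v :=
  congrArg υ (ofCoord_toCoord hy v)

theorem bilinCoord_toCoord (hy : y ∈ (extChartAt (𝓡 n) x₀).source)
    (b : TangentSpace (𝓡 n) y →L[ℝ] TangentSpace (𝓡 n) y →L[ℝ] ℝ) (v w : TangentSpace (𝓡 n) y) :
    bilinCoord x₀ y b (toCoord x₀ y v) (toCoord x₀ y w) = b v w :=
  congrArg₂ (fun v w ↦ b v w) (ofCoord_toCoord hy v) (ofCoord_toCoord hy w)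

theorem contMDiffAt_endomorphism_iff (hy : y ∈ (extChartAt (𝓡 n) x₀).source)
    {A : Π x : M, TangentSpace (𝓡 n) x →L[ℝ] TangentSpace (𝓡 n) x} :
    ContMDiffAt (𝓡 n) ((𝓡 n).prod 𝓘(ℝ, 𝔼 →L[ℝ] 𝔼)) ∞
      (fun x ↦ TotalSpace.mk' (𝔼 →L[ℝ] 𝔼)
        (E := fun x : M ↦ TangentSpace (𝓡 n) x →L[ℝ] TangentSpace (𝓡 n) x) x (A x)) y ↔
    ContDiffAt ℝ ∞ (fun z ↦ endoCoord x₀ ((extChartAt (𝓡 n) x₀).symm z)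
      (A ((extChartAt (𝓡 n) x₀).symm z))) (extChartAt (𝓡 n) x₀ y) := by
  rw [← contMDiffAt_iff_contDiffAt_chart (f := fun x ↦ endoCoord x₀ x (A x)) hy,
    Trivialization.contMDiffAt_section_iff (trivializationAt (𝔼 →L[ℝ] 𝔼)
      (fun x : M ↦ TangentSpace (𝓡 n) x →L[ℝ] TangentSpace (𝓡 n) x) x₀) (by simpa using hy)]
  rfl

theorem contMDiffAt_covector_iff (hy : y ∈ (extChartAt (𝓡 n) x₀).source)
    {Υ : CovectorField n M} :
    ContMDiffAt (𝓡 n) ((𝓡 n).prod 𝓘(ℝ, 𝔼 →L[ℝ] ℝ)) ∞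
      (fun x ↦ TotalSpace.mk' (𝔼 →L[ℝ] ℝ)
        (E := fun x : M ↦ TangentSpace (𝓡 n) x →L[ℝ] Trivial M ℝ x) x (Υ x)) y ↔
    ContDiffAt ℝ ∞ (fun z ↦ covCoord x₀ ((extChartAt (𝓡 n) x₀).symm z)
      (Υ ((extChartAt (𝓡 n) x₀).symm z))) (extChartAt (𝓡 n) x₀ y) := by
  rw [← contMDiffAt_iff_contDiffAt_chart (f := fun x ↦ covCoord x₀ x (Υ x)) hy,
    Trivialization.contMDiffAt_section_iff (trivializationAt (𝔼 →L[ℝ] ℝ)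
      (fun x : M ↦ TangentSpace (𝓡 n) x →L[ℝ] Trivial M ℝ x) x₀) (by simpa using hy)]
  apply Filter.EventuallyEq.contMDiffAt_iff
  refine Filter.Eventually.of_forall fun x ↦ ?_
  ext c
  dsimp only
  rw [hom_trivializationAt_apply]
  simp [ContinuousLinearMap.inCoordinates, covCoord, ofCoord]

theorem contMDiffAt_bilin_iff (hy : y ∈ (extChartAt (𝓡 n) x₀).source) {g : BilinField n M} :
    ContMDiffAt (𝓡 n) ((𝓡 n).prod 𝓘(ℝ, 𝔼 →L[ℝ] 𝔼 →L[ℝ] ℝ)) ∞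
      (fun x ↦ TotalSpace.mk' (𝔼 →L[ℝ] 𝔼 →L[ℝ] ℝ)
        (E := fun x : M ↦ TangentSpace (𝓡 n) x →L[ℝ] TangentSpace (𝓡 n) x →L[ℝ] Trivial M ℝ x)
        x (g x)) y ↔
    ContDiffAt ℝ ∞ (fun z ↦ bilinCoord x₀ ((extChartAt (𝓡 n) x₀).symm z)
      (g ((extChartAt (𝓡 n) x₀).symm z))) (extChartAt (𝓡 n) x₀ y) := by
  rw [← contMDiffAt_iff_contDiffAt_chart (f := fun x ↦ bilinCoord x₀ x (g x)) hy,
    Trivialization.contMDiffAt_section_iff (trivializationAt (𝔼 →L[ℝ] 𝔼 →L[ℝ] ℝ)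
      (fun x : M ↦ TangentSpace (𝓡 n) x →L[ℝ] TangentSpace (𝓡 n) x →L[ℝ] Trivial M ℝ x) x₀)
      (by simpa using hy)]
  apply Filter.EventuallyEq.contMDiffAt_iff
  filter_upwards [extChartAt_source_mem_nhds_of_mem hy] with x hx
  refine ContinuousLinearMap.ext fun c ↦ ContinuousLinearMap.ext fun d ↦ ?_
  rw [hom_trivializationAt_apply]
  dsimp only
  rw [inCoordinates_apply_eq₂ (mem_baseSet hx) (mem_baseSet hx) (mem_univ _)]
  rw [← Trivialization.symmL_apply (R := ℝ) _ (mem_baseSet hx),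
    ← Trivialization.symmL_apply (R := ℝ) _ (mem_baseSet hx)]
  simp [bilinCoord, ofCoord]

/-- The vector field with constant components `c` in the chart at `x₀`. -/
def coordField (x₀ : M) (c : 𝔼) : VField n M := fun y ↦ ofCoord x₀ y c

theorem inChart_coordField {z : 𝔼} (hz : z ∈ (extChartAt (𝓡 n) x₀).target) (c : 𝔼) :
    inChart x₀ (coordField x₀ c) z = c :=
  toCoord_ofCoord ((extChartAt (𝓡 n) x₀).map_target hz) c

theorem smoothAt_coordField (hy : y ∈ (extChartAt (𝓡 n) x₀).source) (c : 𝔼) :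
    SmoothAt (coordField x₀ c) y := by
  rw [smoothAt_iff_inChart hy]
  refine (contDiffAt_const (c := c)).congr_of_eventuallyEq ?_
  filter_upwards [extChartAt_target_mem_nhds_of_mem hy] with z hz using inChart_coordField hz c

/-- The endomorphism `a ↦ ∇_a ∂_c` in the chart at `x₀`. -/
def coordDeriv (D : ConnOp n M) (x₀ : M) (c : 𝔼) (z : 𝔼) : 𝔼 →L[ℝ] 𝔼 :=
  endoCoord x₀ ((extChartAt (𝓡 n) x₀).symm z) (D (coordField x₀ c) ((extChartAt (𝓡 n) x₀).symm z))

theorem coordDeriv_extChartAt (hy : y ∈ (extChartAt (𝓡 n) x₀).source) (D : ConnOp n M) (c : 𝔼) :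
    coordDeriv D x₀ c (extChartAt (𝓡 n) x₀ y) = endoCoord x₀ y (D (coordField x₀ c) y) := by
  rw [coordDeriv, (extChartAt (𝓡 n) x₀).left_inv hy]

/-- The Christoffel symbols of `D` in the chart at `x₀`: `christoffel D x₀ z a c` represents
`∇_a ∂_c`. Linearity in `c` is built in, by expanding `c` in the standard basis. -/
def christoffel (D : ConnOp n M) (x₀ : M) (z : 𝔼) : 𝔼 →L[ℝ] 𝔼 →L[ℝ] 𝔼 :=
  (∑ i : Fin n, (EuclideanSpace.proj i : 𝔼 →L[ℝ] ℝ).smulRight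
    (coordDeriv D x₀ (EuclideanSpace.single i 1) z)).flip

theorem christoffel_apply (D : ConnOp n M) (x₀ : M) (z a c : 𝔼) :
    christoffel D x₀ z a c =
      ∑ i : Fin n, c i • coordDeriv D x₀ (EuclideanSpace.single i 1) z a := by
  simp [christoffel]

theorem isCovariantDerivativeOn_sum {D : ConnOp n M} {U : Set M}
    (hD : IsCovariantDerivativeOn 𝔼 D U) (hy : y ∈ U) {ι : Type*} (s : Finset ι)
    {σ : ι → VField n M} (hσ : ∀ i ∈ s, DiffAt (σ i) y) :
    D (fun x ↦ ∑ i ∈ s, σ i x) y = ∑ i ∈ s, D (σ i) y := by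
  classical
  induction s using Finset.induction_on with
  | empty =>
    simp only [Finset.sum_empty]
    exact hD.zero hy
  | insert i s hi ih =>
    simp only [Finset.sum_insert hi]
    rw [← ih fun j hj ↦ hσ j (Finset.mem_insert_of_mem hj)]
    exact hD.add (hσ i (Finset.mem_insert_self i s))
      (MDifferentiableAt.sum_section fun j hj ↦ hσ j (Finset.mem_insert_of_mem hj)) hy

theorem sum_smul_single (c : 𝔼) : ∑ i, c i • EuclideanSpace.single i (1 : ℝ) = c := by
  ext j
  simp [Pi.single_apply]

/-- A covariant derivative in coordinates is `d + Γ`. -/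
theorem toCoord_covariantDerivative {D : ConnOp n M} {U : Set M} (hU : IsOpen U)
    (hD : IsCovariantDerivativeOn 𝔼 D U) (hyU : y ∈ U)
    (hy : y ∈ (extChartAt (𝓡 n) x₀).source) {Y : VField n M} (hY : DiffAt Y y)
    (v : TangentSpace (𝓡 n) y) :
    toCoord x₀ y (D Y y v) =
      fderiv ℝ (inChart x₀ Y) (extChartAt (𝓡 n) x₀ y) (toCoord x₀ y v) +
        christoffel D x₀ (extChartAt (𝓡 n) x₀ y) (toCoord x₀ y v) (toCoord x₀ y (Y y)) := by
  have hdY := (diffAt_iff_inChart hy).1 hY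
  set f : Fin n → M → ℝ := fun i x ↦ toCoord x₀ x (Y x) i with hf
  have hfc : ∀ i, (fun z ↦ f i ((extChartAt (𝓡 n) x₀).symm z)) =
      fun z ↦ (EuclideanSpace.proj i : 𝔼 →L[ℝ] ℝ) (inChart x₀ Y z) := fun i ↦ rfl
  have hfd : ∀ i, MDifferentiableAt (𝓡 n) 𝓘(ℝ) (f i) y := fun i ↦ by
    rw [mdifferentiableAt_iff_differentiableAt_chart hy, hfc]
    exact (EuclideanSpace.proj i : 𝔼 →L[ℝ] ℝ).differentiableAt.comp _ hdY
  have hfd' : ∀ i, mvfderiv (𝓡 n) (f i) y v =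
      fderiv ℝ (inChart x₀ Y) (extChartAt (𝓡 n) x₀ y) (toCoord x₀ y v) i := fun i ↦ by
    rw [mvfderiv_eq_fderiv_chart hy (hfd i), hfc]
    exact DFunLike.congr_fun ((EuclideanSpace.proj i : 𝔼 →L[ℝ] ℝ).hasFDerivAt.comp _
      hdY.hasFDerivAt).fderiv (toCoord x₀ y v)
  have he : ∀ i, DiffAt (coordField x₀ (EuclideanSpace.single i (1 : ℝ))) y := fun i ↦
    (smoothAt_coordField hy _).diffAt
  have hexp : ∀ᶠ x in 𝓝 y, Y x =
      ∑ i, (f i • coordField x₀ (EuclideanSpace.single i (1 : ℝ))) x := by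
    filter_upwards [extChartAt_source_mem_nhds_of_mem hy] with x hx
    refine toCoord_injective hx ?_
    simp only [Pi.smul_apply', coordField, map_sum, map_smul, toCoord_ofCoord hx]
    exact (sum_smul_single _).symm
  have hsm : ∀ i, DiffAt (f i • coordField x₀ (EuclideanSpace.single i (1 : ℝ))) y := fun i ↦
    MDifferentiableAt.smul_section (hfd i) (he i)
  rw [hD.congr_of_eventuallyEq hY (MDifferentiableAt.sum_section fun i _ ↦ hsm i)
    (hU.mem_nhds hyU) hexp, isCovariantDerivativeOn_sum hD hyU Finset.univ fun i _ ↦ hsm i]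
  have hl : ∀ i, D (f i • coordField x₀ (EuclideanSpace.single i (1 : ℝ))) y v =
      f i y • D (coordField x₀ (EuclideanSpace.single i (1 : ℝ))) y v +
        mvfderiv (𝓡 n) (f i) y v • ofCoord x₀ y (EuclideanSpace.single i (1 : ℝ)) := fun i ↦ by
    rw [hD.leibniz (he i) (hfd i) hyU]
    rfl
  have hc : ∀ i, toCoord x₀ y (D (coordField x₀ (EuclideanSpace.single i (1 : ℝ))) y v) =
      coordDeriv D x₀ (EuclideanSpace.single i 1) (extChartAt (𝓡 n) x₀ y) (toCoord x₀ y v) := by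
    intro i
    rw [coordDeriv_extChartAt hy, endoCoord_toCoord hy]
  rw [_root_.sum_apply, map_sum]
  simp only [hl, map_add, map_smul, hc, toCoord_ofCoord hy, hfd', Finset.sum_add_distrib,
    sum_smul_single, christoffel_apply]
  exact add_comm _ _

/-- Smoothness of a connection is only tested on vector fields that are smooth on all of `U`, so the
coordinate fields, which are smooth only in the chart domain, are cut off by a bump function. -/
theorem contDiffAt_coordDeriv [T2Space M] {D : ConnOp n M} {U : Set M} (hU : IsOpen U)
    (hD : IsTorsionFreeConnectionOn D U) (hyU : y ∈ U)
    (hy : y ∈ (extChartAt (𝓡 n) x₀).source) (c : 𝔼) :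
    ContDiffAt ℝ ∞ (coordDeriv D x₀ c) (extChartAt (𝓡 n) x₀ y) := by
  obtain ⟨χ, -, hχ⟩ := (SmoothBumpFunction.nhds_basis_tsupport (I := 𝓡 n) y).mem_iff.1
    (extChartAt_source_mem_nhds_of_mem hy)
  have hsm : ContMDiff (𝓡 n) ((𝓡 n).prod 𝓘(ℝ, 𝔼)) ∞
      (fun x ↦ TotalSpace.mk' 𝔼 x (((χ : M → ℝ) • coordField x₀ c) x)) :=
    ContMDiffOn.smul_section_of_tsupport χ.contMDiff.contMDiffOn (isOpen_extChartAt_source x₀) hχ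
      fun x hx ↦ (smoothAt_coordField hx c).contMDiffWithinAt
  have hs := (hD.smooth.contMDiff (σ := (χ : M → ℝ) • coordField x₀ c) hsm.contMDiffOn).contMDiffAt
    (hU.mem_nhds hyU)
  refine (contMDiffAt_endomorphism_iff hy).1 ?_
  refine hs.congr_of_eventuallyEq ?_
  filter_upwards [hU.mem_nhds hyU, extChartAt_source_mem_nhds_of_mem hy,
    χ.eventuallyEq_one.eventuallyEq_nhds] with x hxU hx hx1
  congr 1
  refine hD.isCovariantDerivative.congr_of_eventuallyEq (smoothAt_coordField hx c).diffAt
    ((hsm x).mdifferentiableAt (by simp)) (hU.mem_nhds hxU) ?_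
  filter_upwards [hx1] with x' hx'
  simp [hx']

theorem contDiffAt_christoffel [T2Space M] {D : ConnOp n M} {U : Set M} (hU : IsOpen U)
    (hD : IsTorsionFreeConnectionOn D U) (hyU : y ∈ U)
    (hy : y ∈ (extChartAt (𝓡 n) x₀).source) :
    ContDiffAt ℝ ∞ (christoffel D x₀) (extChartAt (𝓡 n) x₀ y) := by
  refine (ContinuousLinearMap.flipₗᵢ ℝ 𝔼 𝔼 𝔼).contDiff.contDiffAt.comp _ ?_
  refine ContDiffAt.sum fun i _ ↦ ?_
  exact (ContinuousLinearMap.smulRightL ℝ 𝔼 (𝔼 →L[ℝ] 𝔼)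
    (EuclideanSpace.proj i : 𝔼 →L[ℝ] ℝ)).contDiff.contDiffAt.comp _
      (contDiffAt_coordDeriv hU hD hyU hy _)

theorem fderiv_inChart_coordField (hy : y ∈ (extChartAt (𝓡 n) x₀).source) (c : 𝔼) :
    fderiv ℝ (inChart x₀ (coordField x₀ c)) (extChartAt (𝓡 n) x₀ y) = 0 := by
  have : inChart x₀ (coordField x₀ c) =ᶠ[𝓝 (extChartAt (𝓡 n) x₀ y)] fun _ ↦ c := by
    filter_upwards [extChartAt_target_mem_nhds_of_mem hy] with z hz using inChart_coordField hz c
  rw [this.fderiv_eq]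
  exact fderiv_const_apply c

theorem christoffel_eq_endoCoord {D : ConnOp n M} {U : Set M} (hU : IsOpen U)
    (hD : IsCovariantDerivativeOn 𝔼 D U) (hyU : y ∈ U)
    (hy : y ∈ (extChartAt (𝓡 n) x₀).source) (a c : 𝔼) :
    christoffel D x₀ (extChartAt (𝓡 n) x₀ y) a c = endoCoord x₀ y (D (coordField x₀ c) y) a := by
  rw [← toCoord_ofCoord hy a, endoCoord_toCoord hy,
    toCoord_covariantDerivative hU hD hyU hy (smoothAt_coordField hy c).diffAt,
    fderiv_inChart_coordField hy c, coordField, toCoord_ofCoord hy, toCoord_ofCoord hy,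
    _root_.zero_apply, zero_add]

theorem christoffel_symm {D : ConnOp n M} {U : Set M} (hU : IsOpen U)
    (hD : IsTorsionFreeConnectionOn D U) (hyU : y ∈ U)
    (hy : y ∈ (extChartAt (𝓡 n) x₀).source) (a b : 𝔼) :
    christoffel D x₀ (extChartAt (𝓡 n) x₀ y) a b =
      christoffel D x₀ (extChartAt (𝓡 n) x₀ y) b a := by
  have ha := (smoothAt_coordField hy a).diffAt
  have hb := (smoothAt_coordField hy b).diffAt
  have h := congrArg (toCoord x₀ y) (hD.torsionFree y hyU _ _ ha hb)
  rw [map_sub, toCoord_mlieBracket hy ha hb, VectorField.lieBracket_eq] at h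
  dsimp only at h
  rw [fderiv_inChart_coordField hy, fderiv_inChart_coordField hy, _root_.zero_apply,
    _root_.zero_apply, sub_self] at h
  rw [christoffel_eq_endoCoord hU hD.isCovariantDerivative hyU hy,
    christoffel_eq_endoCoord hU hD.isCovariantDerivative hyU hy]
  exact sub_eq_zero.1 h

end ChartTensors

/-! ### Curvature of a connection in a chart -/

section

variable {E : Type*} [NormedAddCommGroup E] [NormedSpace ℝ E]

/-- The covariant derivative of `Z` along `Y` in coordinates, for the Christoffel symbols `Γ`. -/
def covDeriv (Γ : E → E →L[ℝ] E →L[ℝ] E) (Z Y : E → E) (z : E) : E :=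
  fderiv ℝ Z z (Y z) + Γ z (Y z) (Z z)

theorem hasFDerivAt_covDeriv {Γ : E → E →L[ℝ] E →L[ℝ] E} {Z Y : E → E} {z : E}
    (hΓ : DifferentiableAt ℝ Γ z) (hZ : ContDiffAt ℝ ∞ Z z) (hY : DifferentiableAt ℝ Y z) :
    DifferentiableAt ℝ (covDeriv Γ Z Y) z ∧ ∀ x, fderiv ℝ (covDeriv Γ Z Y) z x =
      fderiv ℝ (fderiv ℝ Z) z x (Y z) + fderiv ℝ Z z (fderiv ℝ Y z x) +
        (fderiv ℝ Γ z x (Y z) (Z z) + Γ z (fderiv ℝ Y z x) (Z z) +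
          Γ z (Y z) (fderiv ℝ Z z x)) := by
  have hZ1 : DifferentiableAt ℝ (fderiv ℝ Z) z :=
    (hZ.fderiv_right (m := 1) (one_add_one_eq_two.trans_le two_le_infty)).differentiableAt (by simp)
  have hZ0 : DifferentiableAt ℝ Z z := hZ.differentiableAt (by simp)
  have h := (hZ1.hasFDerivAt.clm_apply hY.hasFDerivAt).add
    ((hΓ.hasFDerivAt.clm_apply hY.hasFDerivAt).clm_apply hZ0.hasFDerivAt)
  refine ⟨h.differentiableAt, fun x ↦ ?_⟩
  have h' : fderiv ℝ (covDeriv Γ Z Y) z = _ := h.fderiv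
  rw [h']
  simp
  abel

/-- The Ricci identity in coordinates. -/
theorem covDeriv_commutator {Γ : E → E →L[ℝ] E →L[ℝ] E} {X Y Z : E → E} {z : E}
    (hΓ : DifferentiableAt ℝ Γ z) (hZ : ContDiffAt ℝ ∞ Z z) (hX : DifferentiableAt ℝ X z)
    (hY : DifferentiableAt ℝ Y z) :
    covDeriv Γ (covDeriv Γ Z Y) X z - covDeriv Γ (covDeriv Γ Z X) Y z -
      covDeriv Γ Z (VectorField.lieBracket ℝ X Y) z = riem Γ z (X z) (Y z) (Z z) := by
  have hs := (hZ.of_le two_le_infty).isSymmSndFDerivAt (by simp) (X z) (Y z)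
  have hu : ∀ V W : E → E, covDeriv Γ V W z = fderiv ℝ V z (W z) + Γ z (W z) (V z) :=
    fun _ _ ↦ rfl
  rw [hu, hu (covDeriv Γ Z X), hu Z Y, hu Z X, hu Z, (hasFDerivAt_covDeriv hΓ hZ hY).2,
    (hasFDerivAt_covDeriv hΓ hZ hX).2,
    VectorField.lieBracket_eq, riem_apply, hs]
  simp only [map_add, map_sub, _root_.sub_apply]
  abel

end

section

variable {n : ℕ} {M : Type*} [TopologicalSpace M] [ChartedSpace (EuclideanSpace ℝ (Fin n)) M]
  {x₀ y : M}

local notation "𝔼" => EuclideanSpace ℝ (Fin n)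

/-- The contraction with the standard basis that defines the Ricci tensor is the trace, and hence
does not depend on the basis. -/
theorem sum_stdCoord_eq_trace (S : TangentSpace (𝓡 n) y →ₗ[ℝ] TangentSpace (𝓡 n) y) :
    ∑ i, stdCoord (S (stdVec y i)) i = LinearMap.trace ℝ (TangentSpace (𝓡 n) y) S := by
  have h : ∀ S : 𝔼 →ₗ[ℝ] 𝔼, ∑ i, S (EuclideanSpace.single i 1) i = LinearMap.trace ℝ 𝔼 S := by
    intro S
    rw [LinearMap.trace_eq_matrix_trace ℝ (EuclideanSpace.basisFun (Fin n) ℝ).toBasis,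
      Matrix.trace]
    simp [LinearMap.toMatrix_apply]
  exact h S

variable [IsManifold (𝓡 n) ∞ M]

theorem SmoothAt.eventually_diffAt {Y : VField n M} (h : SmoothAt Y y) :
    ∀ᶠ x in 𝓝 y, DiffAt Y x := by
  have h1 : ContMDiffAt (𝓡 n) ((𝓡 n).prod 𝓘(ℝ, 𝔼)) 1 (fun y ↦ TotalSpace.mk' 𝔼 y (Y y)) y :=
    ContMDiffAt.of_le h (by simp)
  have : IsManifold (𝓡 n) 1 M := IsManifold.of_le (n := ∞) (by simp)
  filter_upwards [(contMDiffAt_iff_contMDiffAt_nhds (by simp)).1 h1] with x hx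
    using hx.mdifferentiableAt (by simp)

theorem eventually_inChart_covariantDerivative {D : ConnOp n M} {U : Set M} (hU : IsOpen U)
    (hD : IsCovariantDerivativeOn 𝔼 D U) (hyU : y ∈ U)
    (hy : y ∈ (extChartAt (𝓡 n) x₀).source) {Y Z : VField n M} (hZ : SmoothAt Z y) :
    inChart x₀ (fun x ↦ D Z x (Y x)) =ᶠ[𝓝 (extChartAt (𝓡 n) x₀ y)]
      covDeriv (christoffel D x₀) (inChart x₀ Z) (inChart x₀ Y) := by
  have hc : ContinuousAt (extChartAt (𝓡 n) x₀).symm (extChartAt (𝓡 n) x₀ y) :=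
    (contMDiffAt_extChartAt_symm_apply hy).continuousAt
  have hev : ∀ᶠ x in 𝓝 ((extChartAt (𝓡 n) x₀).symm (extChartAt (𝓡 n) x₀ y)),
      DiffAt Z x ∧ x ∈ U := by
    rw [(extChartAt (𝓡 n) x₀).left_inv hy]
    exact hZ.eventually_diffAt.and (hU.mem_nhds hyU)
  filter_upwards [hc.eventually hev, extChartAt_target_mem_nhds_of_mem hy] with z hz hzt
  have h := toCoord_covariantDerivative hU hD hz.2 ((extChartAt (𝓡 n) x₀).map_target hzt) hz.1
    (Y ((extChartAt (𝓡 n) x₀).symm z))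
  rwa [(extChartAt (𝓡 n) x₀).right_inv hzt] at h

/-- In coordinates, the curvature operator is the curvature of the Christoffel symbols. -/
theorem toCoord_curvatureOp [T2Space M] {D : ConnOp n M} {U : Set M} (hU : IsOpen U)
    (hD : IsTorsionFreeConnectionOn D U) (hyU : y ∈ U)
    (hy : y ∈ (extChartAt (𝓡 n) x₀).source) {X Y Z : VField n M} (hX : SmoothAt X y)
    (hY : SmoothAt Y y) (hZ : SmoothAt Z y) :
    toCoord x₀ y (curvatureOp D X Y Z y) =
      riem (christoffel D x₀) (extChartAt (𝓡 n) x₀ y) (toCoord x₀ y (X y)) (toCoord x₀ y (Y y))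
        (toCoord x₀ y (Z y)) := by
  have hcov := hD.isCovariantDerivative
  have hΓ := (contDiffAt_christoffel (x₀ := x₀) hU hD hyU hy).differentiableAt (by simp)
  have hX' := (diffAt_iff_inChart hy).1 hX.diffAt
  have hY' := (diffAt_iff_inChart hy).1 hY.diffAt
  have hZ' := (smoothAt_iff_inChart hy).1 hZ
  have hev := fun V : VField n M ↦
    eventually_inChart_covariantDerivative (Y := V) hU hcov hyU hy hZ
  have hstep : ∀ V V' : VField n M, DiffAt V y →
      toCoord x₀ y (D (fun x ↦ D Z x (V x)) y (V' y)) =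
        covDeriv (christoffel D x₀) (covDeriv (christoffel D x₀) (inChart x₀ Z) (inChart x₀ V))
          (inChart x₀ V') (extChartAt (𝓡 n) x₀ y) := by
    intro V V' hV
    have hd : DiffAt (fun x ↦ D Z x (V x)) y := by
      rw [diffAt_iff_inChart hy, (hev V).differentiableAt_iff]
      exact (hasFDerivAt_covDeriv hΓ hZ' ((diffAt_iff_inChart hy).1 hV)).1
    rw [toCoord_covariantDerivative hU hcov hyU hy hd, (hev V).fderiv_eq,
      ← inChart_extChartAt hy (fun x ↦ D Z x (V x)), (hev V).eq_of_nhds, ← inChart_extChartAt hy V']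
    rfl
  rw [curvatureOp, map_sub, map_sub, hstep Y X hY.diffAt, hstep X Y hX.diffAt,
    toCoord_covariantDerivative hU hcov hyU hy hZ.diffAt,
    toCoord_mlieBracket hy hX.diffAt hY.diffAt,
    ← inChart_extChartAt hy X, ← inChart_extChartAt hy Y, ← inChart_extChartAt hy Z]
  exact covDeriv_commutator hΓ hZ' hX' hY'

theorem smoothAt_extend (u : TangentSpace (𝓡 n) y) : SmoothAt (FiberBundle.extend 𝔼 u) y :=
  FiberBundle.contMDiffAt_extend (𝓡 n) 𝔼 u

theorem toCoord_curvature [T2Space M] {D : ConnOp n M} {U : Set M} (hU : IsOpen U)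
    (hD : IsTorsionFreeConnectionOn D U) (hyU : y ∈ U)
    (hy : y ∈ (extChartAt (𝓡 n) x₀).source) (u v w : TangentSpace (𝓡 n) y) :
    toCoord x₀ y (curvature D y u v w) =
      riem (christoffel D x₀) (extChartAt (𝓡 n) x₀ y) (toCoord x₀ y u) (toCoord x₀ y v)
        (toCoord x₀ y w) := by
  rw [curvature, toCoord_curvatureOp hU hD hyU hy (smoothAt_extend u) (smoothAt_extend v)
    (smoothAt_extend w)]
  simp only [FiberBundle.extend_apply_self]

/-- The chart at `x₀` identifies the tangent space at `y` with `ℝⁿ`. -/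
def coordEquiv (hy : y ∈ (extChartAt (𝓡 n) x₀).source) : TangentSpace (𝓡 n) y ≃ₗ[ℝ] 𝔼 :=
  LinearEquiv.ofLinearMap (toCoord x₀ y).toLinearMap (ofCoord x₀ y).toLinearMap
    (LinearMap.ext (toCoord_ofCoord hy)) (LinearMap.ext (ofCoord_toCoord hy))

theorem ricci_eq_ricOf [T2Space M] {D : ConnOp n M} {U : Set M} (hU : IsOpen U)
    (hD : IsTorsionFreeConnectionOn D U) (hyU : y ∈ U)
    (hy : y ∈ (extChartAt (𝓡 n) x₀).source) (u v : TangentSpace (𝓡 n) y) :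
    ricci D y u v = ricOf (riem (christoffel D x₀) (extChartAt (𝓡 n) x₀ y)) (toCoord x₀ y u)
      (toCoord x₀ y v) := by
  set T : 𝔼 →ₗ[ℝ] 𝔼 := ((riem (christoffel D x₀) (extChartAt (𝓡 n) x₀ y)).flip
    (toCoord x₀ y u)).flip (toCoord x₀ y v) with hT
  set e := coordEquiv (n := n) hy
  have hcurv : ∀ w, curvature D y w u v = e.symm.conj T w := fun w ↦ by
    refine toCoord_injective hy ?_
    rw [toCoord_curvature hU hD hyU hy]
    exact (toCoord_ofCoord hy _).symm
  simp only [ricci, hcurv]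
  rw [sum_stdCoord_eq_trace, LinearMap.trace_conj']
  rfl

/-- In coordinates, the projective Weyl tensor is the one of the Christoffel symbols. -/
theorem toCoord_weyl [T2Space M] {D : ConnOp n M} {U : Set M} (hU : IsOpen U)
    (hD : IsTorsionFreeConnectionOn D U) (hyU : y ∈ U)
    (hy : y ∈ (extChartAt (𝓡 n) x₀).source) (u v w : TangentSpace (𝓡 n) y) :
    toCoord x₀ y (weyl D y u v w) =
      weylOf (riem (christoffel D x₀) (extChartAt (𝓡 n) x₀ y)) (toCoord x₀ y u) (toCoord x₀ y v)
        (toCoord x₀ y w) := by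
  simp only [weyl, weylOf, beta, schouten, schOf, map_sub, map_smul, ricci_eq_ricOf hU hD hyU hy,
    toCoord_curvature hU hD hyU hy, finrank_euclideanSpace, Fintype.card_fin]

end

/-! ### Einstein metrics have vanishing projective Weyl tensor -/

section

variable {n : ℕ} {M : Type*} [TopologicalSpace M] [ChartedSpace (EuclideanSpace ℝ (Fin n)) M]
  {x₀ y : M}

local notation "𝔼" => EuclideanSpace ℝ (Fin n)

theorem eventually_exists_extChartAt_eq {U : Set M} (hU : IsOpen U) (hyU : y ∈ U)
    (hy : y ∈ (extChartAt (𝓡 n) x₀).source) :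
    ∀ᶠ z in 𝓝 (extChartAt (𝓡 n) x₀ y), ∃ x ∈ U, x ∈ (extChartAt (𝓡 n) x₀).source ∧
      extChartAt (𝓡 n) x₀ x = z := by
  have hc : ContinuousAt (extChartAt (𝓡 n) x₀).symm (extChartAt (𝓡 n) x₀ y) :=
    continuousAt_extChartAt_symm' hy
  have hev : ∀ᶠ x in 𝓝 ((extChartAt (𝓡 n) x₀).symm (extChartAt (𝓡 n) x₀ y)), x ∈ U := by
    rw [(extChartAt (𝓡 n) x₀).left_inv hy]
    exact hU.mem_nhds hyU
  filter_upwards [hc.eventually hev, extChartAt_target_mem_nhds_of_mem hy] with z hz hzt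
  exact ⟨_, hz, (extChartAt (𝓡 n) x₀).map_target hzt, (extChartAt (𝓡 n) x₀).right_inv hzt⟩

variable [IsManifold (𝓡 n) ∞ M]

theorem christoffel_of_projective_change {D D' : ConnOp n M} {U : Set M} (hU : IsOpen U)
    (hD : IsCovariantDerivativeOn 𝔼 D U) (hD' : IsCovariantDerivativeOn 𝔼 D' U)
    {Υ : CovectorField n M}
    (h : ∀ x ∈ U, ∀ Y : VField n M, DiffAt Y x → ∀ v : TangentSpace (𝓡 n) x,
      D' Y x v = D Y x v + Υ x v • Y x + Υ x (Y x) • v)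
    (hyU : y ∈ U) (hy : y ∈ (extChartAt (𝓡 n) x₀).source) :
    christoffel D' x₀ (extChartAt (𝓡 n) x₀ y) =
      christoffel D x₀ (extChartAt (𝓡 n) x₀ y) + projTerm (covCoord x₀ y (Υ y)) := by
  ext1 a
  ext1 c
  rw [_root_.add_apply, _root_.add_apply, projTerm_apply, christoffel_eq_endoCoord hU hD' hyU hy,
    christoffel_eq_endoCoord hU hD hyU hy, ← toCoord_ofCoord hy a, ← toCoord_ofCoord hy c,
    endoCoord_toCoord hy, endoCoord_toCoord hy, covCoord_toCoord hy, covCoord_toCoord hy,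
    toCoord_ofCoord hy c, h y hyU _ (smoothAt_coordField hy c).diffAt, map_add, map_add, map_smul,
    map_smul, coordField, toCoord_ofCoord hy c, add_assoc]

/-- Compatibility of a connection with a metric, in coordinates. -/
theorem fderiv_bilinCoord_of_isLeviCivitaOn {D : ConnOp n M} {g : BilinField n M} {U : Set M}
    (hU : IsOpen U) (hg : IsMetricOn g U) (hD : IsLeviCivitaOn D g U) (hyU : y ∈ U)
    (hy : y ∈ (extChartAt (𝓡 n) x₀).source) (u v w : 𝔼) :
    fderiv ℝ (fun z ↦ bilinCoord x₀ ((extChartAt (𝓡 n) x₀).symm z)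
      (g ((extChartAt (𝓡 n) x₀).symm z))) (extChartAt (𝓡 n) x₀ y) u v w =
      bilinCoord x₀ y (g y) (christoffel D x₀ (extChartAt (𝓡 n) x₀ y) u v) w +
        bilinCoord x₀ y (g y) v (christoffel D x₀ (extChartAt (𝓡 n) x₀ y) u w) := by
  have hgd := ((contMDiffAt_bilin_iff hy).1
    (hg.smooth.contMDiffAt (hU.mem_nhds hyU))).differentiableAt (by simp)
  have hcov := hD.1.isCovariantDerivative
  have hf : MDifferentiableAt (𝓡 n) 𝓘(ℝ) (fun x ↦ g x (coordField x₀ v x) (coordField x₀ w x))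
      y := by
    rw [mdifferentiableAt_iff_differentiableAt_chart hy]
    exact (hgd.clm_apply (differentiableAt_const v)).clm_apply (differentiableAt_const w)
  have h := hD.2 y hyU _ _ (smoothAt_coordField hy v).diffAt (smoothAt_coordField hy w).diffAt
    (ofCoord x₀ y u)
  rw [mvfderiv_eq_fderiv_chart hy hf, toCoord_ofCoord hy, ← bilinCoord_toCoord hy,
    ← bilinCoord_toCoord hy, ← endoCoord_toCoord hy, ← endoCoord_toCoord hy, toCoord_ofCoord hy,
    ← christoffel_eq_endoCoord hU hcov hyU hy, ← christoffel_eq_endoCoord hU hcov hyU hy,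
    coordField, coordField, toCoord_ofCoord hy, toCoord_ofCoord hy] at h
  rw [← h, ← fderiv_apply_apply hgd]
  rfl

end

section

variable {M : Type*} [TopologicalSpace M] [T2Space M] [ChartedSpace (EuclideanSpace ℝ (Fin 3)) M]
  [IsManifold (𝓡 3) ∞ M]

local notation "𝔼" => EuclideanSpace ℝ (Fin 3)

/-- The Levi-Civita connection of an Einstein metric on a three-manifold is projectively
Weyl-flat. -/
theorem weylOf_riem_christoffel_eq_zero_of_einstein {D : ConnOp 3 M} {g : BilinField 3 M}
    {U : Set M} (hU : IsOpen U) (hg : IsMetricOn g U) (hD : IsLeviCivitaOn D g U) {c : ℝ}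
    (hc : ∀ x ∈ U, ∀ u v, ricci D x u v = c * g x u v) {x₀ y : M} (hyU : y ∈ U)
    (hy : y ∈ (extChartAt (𝓡 3) x₀).source) :
    ∀ u v w, weylOf (riem (christoffel D x₀) (extChartAt (𝓡 3) x₀ y)) u v w = 0 := by
  have hΓ := (contDiffAt_christoffel (x₀ := x₀) hU hD.1 hyU hy).differentiableAt (by simp)
  have hgc := (contMDiffAt_bilin_iff hy).1 (hg.smooth.contMDiffAt (hU.mem_nhds hyU))
  have hev := eventually_exists_extChartAt_eq hU hyU hy
  have hto : ∀ b d : 𝔼, bilinCoord x₀ y (g y) b d = g y (ofCoord x₀ y b) (ofCoord x₀ y d) :=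
    fun _ _ ↦ rfl
  refine weylOf_eq_zero_of_einstein (by simp) (g := (bilinCoord x₀ y (g y)).toLinearMap₁₂)
    (c := c) ?_ ?_ (riem_antisymm _ _) (riem_bianchi hΓ ?_) ?_ ?_
  · intro v w
    exact hg.symm y hyU _ _
  · intro v hv
    have := hg.nondegenerate y hyU (ofCoord x₀ y v) fun w ↦ by
      have := hv (toCoord x₀ y w)
      rwa [ContinuousLinearMap.toLinearMap₁₂_apply_apply_apply, hto, ofCoord_toCoord hy] at this
    rw [← toCoord_ofCoord hy v, this, map_zero]
  · filter_upwards [hev] with z hz u v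
    obtain ⟨x, hxU, hx, rfl⟩ := hz
    exact christoffel_symm hU hD.1 hxU hx u v
  · intro u v w x
    have := riem_metric_skew hΓ hgc (by
      filter_upwards [hev] with z hz u v w
      obtain ⟨x, hxU, hx, rfl⟩ := hz
      rw [fderiv_bilinCoord_of_isLeviCivitaOn hU hg hD hxU hx, (extChartAt (𝓡 3) x₀).left_inv hx])
      u v w x
    rwa [(extChartAt (𝓡 3) x₀).left_inv hy] at this
  · intro u v
    have := ricci_eq_ricOf hU hD.1 hyU hy (ofCoord x₀ y u) (ofCoord x₀ y v)
    rw [hc y hyU, toCoord_ofCoord hy, toCoord_ofCoord hy] at this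
    exact this.symm

/-- The projective Weyl tensor of a connection that is projectively equivalent to the Levi-Civita
connection of an Einstein metric vanishes. -/
theorem weyl_eq_zero_of_hasEinsteinOn {p : ProjectiveStructure 3 M} {D : ConnOp 3 M}
    (hD : D ∈ p.connections) {U : Set M} (hU : IsOpen U) (hE : p.HasEinsteinOn U) {y : M}
    (hyU : y ∈ U) (u v w : TangentSpace (𝓡 3) y) : weyl D y u v w = 0 := by
  obtain ⟨g, D', hg, hLC, ⟨c, hc⟩, hp⟩ := hE
  obtain ⟨Υ, hΥ, hDD'⟩ := hp D hD
  have hDc := p.isConnection D hD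
  have hy := mem_extChartAt_source (I := 𝓡 3) y
  have hΓ := (contDiffAt_christoffel (x₀ := y) isOpen_univ hDc (mem_univ y) hy).differentiableAt
    (by simp)
  have hΥd := ((contMDiffAt_covector_iff hy).1
    (hΥ.contMDiffAt (hU.mem_nhds hyU))).differentiableAt (by simp)
  have hcongr : christoffel D' y =ᶠ[𝓝 (extChartAt (𝓡 3) y y)] fun z ↦ christoffel D y z +
      projTerm (covCoord y ((extChartAt (𝓡 3) y).symm z) (Υ ((extChartAt (𝓡 3) y).symm z))) := by
    filter_upwards [eventually_exists_extChartAt_eq hU hyU hy] with z hz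
    obtain ⟨x, hxU, hx, rfl⟩ := hz
    rw [christoffel_of_projective_change hU (hDc.isCovariantDerivative.mono (subset_univ U))
      hLC.1.isCovariantDerivative hDD' hxU hx, (extChartAt (𝓡 3) y).left_inv hx]
  have hriem : riem (christoffel D' y) (extChartAt (𝓡 3) y y) = riem (fun z ↦ christoffel D y z +
      projTerm (covCoord y ((extChartAt (𝓡 3) y).symm z) (Υ ((extChartAt (𝓡 3) y).symm z))))
      (extChartAt (𝓡 3) y y) := by
    rw [riem, riem, hcongr.fderiv_eq, hcongr.eq_of_nhds]
  have hW := weylOf_riem_christoffel_eq_zero_of_einstein hU hg hLC hc hyU hy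
  rw [hriem, weylOf_riem_add_projTerm (by simp) hΓ hΥd
    (christoffel_symm isOpen_univ hDc (mem_univ y) hy)] at hW
  refine toCoord_injective hy ?_
  rw [toCoord_weyl isOpen_univ hDc (mem_univ y) hy, hW, map_zero]

end

/-! ### Flat metrics from a vanishing projective Weyl tensor -/

section FlatMetric

variable {n : ℕ} {M : Type*} [TopologicalSpace M] [ChartedSpace (EuclideanSpace ℝ (Fin n)) M]
  {x₀ y : M}

local notation "𝔼" => EuclideanSpace ℝ (Fin n)

/-- The projective change of the connection `D` by the 1-form `Υ`. -/
def projChange (D : ConnOp n M) (Υ : CovectorField n M) : ConnOp n M :=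
  fun Y x ↦ D Y x + (Υ x).smulRight (Y x) + Υ x (Y x) • ContinuousLinearMap.id ℝ _

theorem projChange_apply (D : ConnOp n M) (Υ : CovectorField n M) (Y : VField n M) (x : M)
    (v : TangentSpace (𝓡 n) x) :
    projChange D Υ Y x v = D Y x v + Υ x v • Y x + Υ x (Y x) • v :=
  rfl

theorem isCovariantDerivativeOn_projChange [IsManifold (𝓡 n) ∞ M] {D : ConnOp n M} {U : Set M}
    (hD : IsCovariantDerivativeOn 𝔼 D U) (Υ : CovectorField n M) :
    IsCovariantDerivativeOn 𝔼 (projChange D Υ) U where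
  add hσ hσ' hx := by
    ext1 v
    simp only [projChange_apply, hD.add hσ hσ' hx, _root_.add_apply, Pi.add_apply, map_add]
    module
  leibniz hσ hg hx := by
    ext1 v
    simp only [projChange_apply, hD.leibniz hσ hg hx, _root_.add_apply, _root_.smul_apply,
      Pi.smul_apply', map_smul, ContinuousLinearMap.smulRight_apply, smul_eq_mul]
    module

variable [IsManifold (𝓡 n) ∞ M]

theorem endoCoord_covariantDerivative {D : ConnOp n M} {U : Set M} (hU : IsOpen U)
    (hD : IsCovariantDerivativeOn 𝔼 D U) (hyU : y ∈ U)
    (hy : y ∈ (extChartAt (𝓡 n) x₀).source) {Y : VField n M} (hY : DiffAt Y y) :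
    endoCoord x₀ y (D Y y) = fderiv ℝ (inChart x₀ Y) (extChartAt (𝓡 n) x₀ y) +
      (christoffel D x₀ (extChartAt (𝓡 n) x₀ y)).flip
        (inChart x₀ Y (extChartAt (𝓡 n) x₀ y)) := by
  ext1 a
  rw [← toCoord_ofCoord hy a, endoCoord_toCoord hy, toCoord_covariantDerivative hU hD hyU hy hY,
    inChart_extChartAt hy]
  rfl

/-- A projective change by a smooth 1-form of a smooth torsion-free connection is again one. -/
theorem IsTorsionFreeConnectionOn.projChange [T2Space M] {D : ConnOp n M} {U V : Set M}
    (hV : IsOpen V) (hD : IsTorsionFreeConnectionOn D V) (hU : IsOpen U) (hUV : U ⊆ V)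
    {Υ : CovectorField n M} (hΥ : SmoothCovectorOn Υ U) :
    IsTorsionFreeConnectionOn (projChange D Υ) U where
  isCovariantDerivative :=
    isCovariantDerivativeOn_projChange (hD.isCovariantDerivative.mono hUV) Υ
  smooth := by
    have hcov := isCovariantDerivativeOn_projChange (hD.isCovariantDerivative.mono hUV) Υ
    refine ⟨fun {σ} hσ x hxU ↦ ContMDiffAt.contMDiffWithinAt ?_⟩
    have hσ' : ∀ x ∈ U, SmoothAt σ x := fun x hx ↦ by
      have := hσ.contMDiffAt (hU.mem_nhds hx)
      exact this.of_le (by simp)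
    have hx := mem_extChartAt_source (I := 𝓡 n) x
    rw [contMDiffAt_endomorphism_iff hx]
    have hσx := (smoothAt_iff_inChart hx).1 (hσ' x hxU)
    have hΓ : ContDiffAt ℝ ∞ (fun z ↦ christoffel D x z + projTerm (covCoord x
        ((extChartAt (𝓡 n) x).symm z) (Υ ((extChartAt (𝓡 n) x).symm z))))
        (extChartAt (𝓡 n) x x) :=
      (contDiffAt_christoffel hV hD (hUV hxU) hx).add
        ((LinearMap.toContinuousLinearMap (projTerm (E := 𝔼))).contDiff.contDiffAt.comp _
          ((contMDiffAt_covector_iff hx).1 (hΥ.contMDiffAt (hU.mem_nhds hxU))))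
    have hmain := (hσx.fderiv_right (m := ∞) (by simp)).add
      (((ContinuousLinearMap.flipₗᵢ ℝ 𝔼 𝔼 𝔼).contDiff.contDiffAt.comp _ hΓ).clm_apply hσx)
    refine hmain.congr_of_eventuallyEq ?_
    filter_upwards [eventually_exists_extChartAt_eq hU hxU hx] with z hz
    obtain ⟨x', hxU', hx', rfl⟩ := hz
    rw [(extChartAt (𝓡 n) x).left_inv hx',
      endoCoord_covariantDerivative hU hcov hxU' hx' (hσ' x' hxU').diffAt,
      christoffel_of_projective_change hU (hD.isCovariantDerivative.mono hUV) hcov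
        (fun x _ Y _ v ↦ projChange_apply D Υ Y x v) hxU' hx']
    rw [Function.comp_apply, (extChartAt (𝓡 n) x).left_inv hx']
    rfl
  torsionFree x hx X Y hX hY := by
    rw [← hD.torsionFree x (hUV hx) X Y hX hY, projChange_apply, projChange_apply]
    abel

theorem ProjectivelyEquivOn.trans_projChange {D D' : ConnOp n M} {U : Set M} (hU : IsOpen U)
    (h : ProjectivelyEquivOn D D' U) {Υ : CovectorField n M} (hΥ : SmoothCovectorOn Υ U) :
    ProjectivelyEquivOn D (projChange D' Υ) U := by
  obtain ⟨Υ', hΥ', hDD'⟩ := h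
  refine ⟨Υ' + Υ, fun x hxU ↦ ContMDiffAt.contMDiffWithinAt ?_, fun x hx Y hY v ↦ ?_⟩
  · have hx := mem_extChartAt_source (I := 𝓡 n) x
    rw [contMDiffAt_covector_iff hx]
    exact ((contMDiffAt_covector_iff hx).1 (hΥ'.contMDiffAt (hU.mem_nhds hxU))).add
      ((contMDiffAt_covector_iff hx).1 (hΥ.contMDiffAt (hU.mem_nhds hxU)))
  · rw [projChange_apply, hDD' x hx Y hY v]
    simp only [Pi.add_apply, _root_.add_apply]
    module

/-- The covector field with components `υ` in the chart at `x₀`. -/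
def covFieldOfCoord (x₀ : M) (υ : 𝔼 → 𝔼 →L[ℝ] ℝ) : CovectorField n M :=
  fun x ↦ (υ (extChartAt (𝓡 n) x₀ x)).comp (toCoord x₀ x)

theorem covCoord_covFieldOfCoord (hy : y ∈ (extChartAt (𝓡 n) x₀).source)
    (υ : 𝔼 → 𝔼 →L[ℝ] ℝ) : covCoord x₀ y (covFieldOfCoord x₀ υ y) = υ (extChartAt (𝓡 n) x₀ y) := by
  ext1 c
  exact congrArg (υ (extChartAt (𝓡 n) x₀ y)) (toCoord_ofCoord hy c)

/-- The field of bilinear forms with components `b` in the chart at `x₀`. -/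
def bilinFieldOfCoord (x₀ : M) (b : 𝔼 → 𝔼 →L[ℝ] 𝔼 →L[ℝ] ℝ) : BilinField n M :=
  fun x ↦ ((toCoord x₀ x).precomp ℝ).comp ((b (extChartAt (𝓡 n) x₀ x)).comp (toCoord x₀ x))

theorem bilinFieldOfCoord_apply (b : 𝔼 → 𝔼 →L[ℝ] 𝔼 →L[ℝ] ℝ) (v w : TangentSpace (𝓡 n) y) :
    bilinFieldOfCoord x₀ b y v w =
      b (extChartAt (𝓡 n) x₀ y) (toCoord x₀ y v) (toCoord x₀ y w) :=
  rfl

theorem bilinCoord_bilinFieldOfCoord (hy : y ∈ (extChartAt (𝓡 n) x₀).source)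
    (b : 𝔼 → 𝔼 →L[ℝ] 𝔼 →L[ℝ] ℝ) :
    bilinCoord x₀ y (bilinFieldOfCoord x₀ b y) = b (extChartAt (𝓡 n) x₀ y) := by
  ext1 c
  ext1 d
  exact congrArg₂ (fun c d ↦ b (extChartAt (𝓡 n) x₀ y) c d) (toCoord_ofCoord hy c)
    (toCoord_ofCoord hy d)

theorem smoothCovectorOn_covFieldOfCoord {W : Set 𝔼} (hW : IsOpen W) {υ : 𝔼 → 𝔼 →L[ℝ] ℝ}
    (hυ : ContDiffOn ℝ ∞ υ W) :
    SmoothCovectorOn (covFieldOfCoord x₀ υ)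
      ((extChartAt (𝓡 n) x₀).source ∩ extChartAt (𝓡 n) x₀ ⁻¹' W) := by
  rintro x ⟨hx, hxW⟩
  refine ContMDiffAt.contMDiffWithinAt ((contMDiffAt_covector_iff hx).2 ?_)
  refine (hυ.contDiffAt (hW.mem_nhds hxW)).congr_of_eventuallyEq ?_
  filter_upwards [extChartAt_target_mem_nhds_of_mem hx] with z hz
  rw [covCoord_covFieldOfCoord ((extChartAt (𝓡 n) x₀).map_target hz),
    (extChartAt (𝓡 n) x₀).right_inv hz]

/-- The pull-back of the standard inner product by the coframe `θ`. -/
def coframeMetric (θ : 𝔼 → 𝔼 →L[ℝ] 𝔼) (z : 𝔼) : 𝔼 →L[ℝ] 𝔼 →L[ℝ] ℝ :=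
  (((innerSL ℝ).comp (θ z)).flip.comp (θ z)).flip

theorem coframeMetric_apply (θ : 𝔼 → 𝔼 →L[ℝ] 𝔼) (z a b : 𝔼) :
    coframeMetric θ z a b = inner ℝ (θ z a) (θ z b) :=
  rfl

theorem contDiffAt_coframeMetric {θ : 𝔼 → 𝔼 →L[ℝ] 𝔼} {z : 𝔼} (hθ : ContDiffAt ℝ ∞ θ z) :
    ContDiffAt ℝ ∞ (coframeMetric θ) z :=
  (ContinuousLinearMap.flipₗᵢ ℝ 𝔼 𝔼 ℝ).contDiff.contDiffAt.comp z
    (((ContinuousLinearMap.flipₗᵢ ℝ 𝔼 𝔼 ℝ).contDiff.contDiffAt.comp z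
      (contDiffAt_const.clm_comp hθ)).clm_comp hθ)

theorem isMetricOn_coframeMetric {W : Set 𝔼} (hW : IsOpen W) {θ : 𝔼 → 𝔼 →L[ℝ] 𝔼}
    (hθ : ContDiffOn ℝ ∞ θ W) (hinj : ∀ z ∈ W, Function.Injective (θ z)) :
    IsMetricOn (bilinFieldOfCoord x₀ (coframeMetric θ))
      ((extChartAt (𝓡 n) x₀).source ∩ extChartAt (𝓡 n) x₀ ⁻¹' W) where
  smooth := by
    rintro x ⟨hx, hxW⟩
    refine ContMDiffAt.contMDiffWithinAt ((contMDiffAt_bilin_iff hx).2 ?_)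
    refine (contDiffAt_coframeMetric
      (hθ.contDiffAt (hW.mem_nhds hxW))).congr_of_eventuallyEq ?_
    filter_upwards [extChartAt_target_mem_nhds_of_mem hx] with z hz
    rw [bilinCoord_bilinFieldOfCoord ((extChartAt (𝓡 n) x₀).map_target hz),
      (extChartAt (𝓡 n) x₀).right_inv hz]
  symm x _ v w := by
    rw [bilinFieldOfCoord_apply, bilinFieldOfCoord_apply, coframeMetric_apply, coframeMetric_apply,
      real_inner_comm]
  nondegenerate x hx v hv := by
    have h := hv v
    rw [bilinFieldOfCoord_apply, coframeMetric_apply, inner_self_eq_zero] at h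
    refine toCoord_injective hx.1 (hinj _ hx.2 ?_)
    rw [h, map_zero, map_zero]

/-- A torsion-free connection for which the coframe `θ` is parallel is the Levi-Civita connection of
the flat metric defined by `θ`. -/
theorem isLeviCivitaOn_coframeMetric {D : ConnOp n M} {W : Set 𝔼} (hW : IsOpen W)
    {θ : 𝔼 → 𝔼 →L[ℝ] 𝔼} (hθ : ContDiffOn ℝ ∞ θ W)
    (hp : ∀ z ∈ W, ∀ u v, fderiv ℝ θ z u v = θ z (christoffel D x₀ z u v))
    (hU : IsOpen ((extChartAt (𝓡 n) x₀).source ∩ extChartAt (𝓡 n) x₀ ⁻¹' W))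
    (hD : IsTorsionFreeConnectionOn D
      ((extChartAt (𝓡 n) x₀).source ∩ extChartAt (𝓡 n) x₀ ⁻¹' W)) :
    IsLeviCivitaOn D (bilinFieldOfCoord x₀ (coframeMetric θ))
      ((extChartAt (𝓡 n) x₀).source ∩ extChartAt (𝓡 n) x₀ ⁻¹' W) := by
  refine ⟨hD, fun x hx Y Z hY hZ v ↦ ?_⟩
  have hθd := (hθ.contDiffAt (hW.mem_nhds hx.2)).differentiableAt (by simp)
  -- The frame components of a vector field are differentiated by covariant differentiation.
  have hcomp : ∀ V : VField n M, DiffAt V x →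
      DifferentiableAt ℝ (fun z ↦ θ z (inChart x₀ V z)) (extChartAt (𝓡 n) x₀ x) ∧
      fderiv ℝ (fun z ↦ θ z (inChart x₀ V z)) (extChartAt (𝓡 n) x₀ x) (toCoord x₀ x v) =
        θ (extChartAt (𝓡 n) x₀ x) (toCoord x₀ x (D V x v)) := by
    intro V hV
    have h := hθd.hasFDerivAt.clm_apply ((diffAt_iff_inChart hx.1).1 hV).hasFDerivAt
    refine ⟨h.differentiableAt, ?_⟩
    rw [h.fderiv, toCoord_covariantDerivative hU hD.isCovariantDerivative hx hx.1 hV, map_add,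
      ← hp _ hx.2, ← inChart_extChartAt hx.1]
    rfl
  have hev : (fun z ↦ (fun x ↦ bilinFieldOfCoord x₀ (coframeMetric θ) x (Y x) (Z x))
      ((extChartAt (𝓡 n) x₀).symm z)) =ᶠ[𝓝 (extChartAt (𝓡 n) x₀ x)]
      fun z ↦ inner ℝ (θ z (inChart x₀ Y z)) (θ z (inChart x₀ Z z)) := by
    filter_upwards [extChartAt_target_mem_nhds_of_mem hx.1] with z hz
    rw [bilinFieldOfCoord_apply, (extChartAt (𝓡 n) x₀).right_inv hz]
    rfl
  have hY' := hcomp Y hY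
  have hZ' := hcomp Z hZ
  rw [mvfderiv_eq_fderiv_chart hx.1 ((mdifferentiableAt_iff_differentiableAt_chart hx.1).2
    (hev.differentiableAt_iff.2 (hY'.1.inner ℝ hZ'.1))), hev.fderiv_eq,
    fderiv_inner_apply ℝ hY'.1 hZ'.1, hY'.2, hZ'.2, inChart_extChartAt hx.1,
    inChart_extChartAt hx.1, bilinFieldOfCoord_apply, bilinFieldOfCoord_apply, coframeMetric_apply,
    coframeMetric_apply, add_comm]

theorem ricci_eq_zero_of_parallel_coframe [T2Space M] {D : ConnOp n M} {W : Set 𝔼} (hW : IsOpen W)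
    {θ : 𝔼 → 𝔼 →L[ℝ] 𝔼} (hθ : ContDiffOn ℝ ∞ θ W)
    (hinj : ∀ z ∈ W, Function.Injective (θ z))
    (hp : ∀ z ∈ W, ∀ u v, fderiv ℝ θ z u v = θ z (christoffel D x₀ z u v)) {U : Set M}
    (hU : IsOpen U) (hD : IsTorsionFreeConnectionOn D U) (hyU : y ∈ U)
    (hy : y ∈ (extChartAt (𝓡 n) x₀).source) (hyW : extChartAt (𝓡 n) x₀ y ∈ W)
    (u v : TangentSpace (𝓡 n) y) : ricci D y u v = 0 := by
  rw [ricci_eq_ricOf hU hD hyU hy, riem_eq_zero_of_parallel_coframe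
    ((contDiffAt_christoffel hU hD hyU hy).differentiableAt (by simp))
    (hθ.contDiffAt (hW.mem_nhds hyW)) (by filter_upwards [hW.mem_nhds hyW] using hp)
    (hinj _ hyW)]
  exact map_zero (LinearMap.trace ℝ 𝔼)

/-- If the projective Weyl tensor vanishes, then locally the projective class contains the
Levi-Civita connection of a flat metric. -/
theorem exists_hasEinsteinOn_of_weylVanishes [T2Space M] (hn : 3 ≤ n) {p : ProjectiveStructure n M}
    {D : ConnOp n M} (hD : D ∈ p.connections) (hW : WeylVanishes D) (x₀ : M) :
    ∃ U : Set M, IsOpen U ∧ x₀ ∈ U ∧ p.HasEinsteinOn U := by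
  have hDc := p.isConnection D hD
  have hsurj : ∀ z ∈ (extChartAt (𝓡 n) x₀).target, ∃ x ∈ (extChartAt (𝓡 n) x₀).source,
      extChartAt (𝓡 n) x₀ x = z := fun z hz ↦
    ⟨_, (extChartAt (𝓡 n) x₀).map_target hz, (extChartAt (𝓡 n) x₀).right_inv hz⟩
  obtain ⟨W, hWt, hWo, hxW, υ, θ, hυ, hθ, hinj, hp⟩ :=
    exists_parallel_coframe (E := 𝔼) (Γ := christoffel D x₀) (by simpa using hn)
      (isOpen_extChartAt_target x₀)
      (fun z hz ↦ by
        obtain ⟨x, hx, rfl⟩ := hsurj z hz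
        exact (contDiffAt_christoffel isOpen_univ hDc (mem_univ x) hx).contDiffWithinAt)
      (fun z hz u v ↦ by
        obtain ⟨x, hx, rfl⟩ := hsurj z hz
        exact christoffel_symm isOpen_univ hDc (mem_univ x) hx u v)
      (fun z hz ↦ by
        obtain ⟨x, hx, rfl⟩ := hsurj z hz
        funext u v w
        rw [← toCoord_ofCoord hx u, ← toCoord_ofCoord hx v, ← toCoord_ofCoord hx w,
          ← toCoord_weyl isOpen_univ hDc (mem_univ x) hx, hW, map_zero]
        rfl)
      (mem_extChartAt_target (I := 𝓡 n) x₀)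
  set U : Set M := (extChartAt (𝓡 n) x₀).source ∩ extChartAt (𝓡 n) x₀ ⁻¹' W with hUdef
  have hU : IsOpen U :=
    (continuousOn_extChartAt x₀).isOpen_inter_preimage (isOpen_extChartAt_source x₀) hWo
  have hΥ : SmoothCovectorOn (covFieldOfCoord x₀ υ) U := smoothCovectorOn_covFieldOfCoord hWo hυ
  have hcov := hDc.isCovariantDerivative.mono (subset_univ U)
  have hD' : IsTorsionFreeConnectionOn (projChange D (covFieldOfCoord x₀ υ)) U :=
    hDc.projChange isOpen_univ hU (subset_univ U) hΥ
  have hp' : ∀ z ∈ W, ∀ u v, fderiv ℝ θ z u v =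
      θ z (christoffel (projChange D (covFieldOfCoord x₀ υ)) x₀ z u v) := by
    intro z hz u v
    obtain ⟨x, hx, rfl⟩ := hsurj z (hWt hz)
    rw [hp _ hz, christoffel_of_projective_change hU hcov hD'.isCovariantDerivative
      (fun x _ Y _ v ↦ projChange_apply _ _ Y x v) ⟨hx, hz⟩ hx, covCoord_covFieldOfCoord hx]
    rfl
  refine ⟨U, hU, ⟨mem_extChartAt_source x₀, hxW⟩, bilinFieldOfCoord x₀ (coframeMetric θ),
    projChange D (covFieldOfCoord x₀ υ), isMetricOn_coframeMetric hWo hθ hinj,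
    isLeviCivitaOn_coframeMetric hWo hθ hp' hU hD', ⟨0, fun x hx u v ↦ ?_⟩, fun D₁ hD₁ ↦ ?_⟩
  · rw [zero_mul]
    exact ricci_eq_zero_of_parallel_coframe hWo hθ hinj hp' hU hD' hx hx.1 hx.2 u v
  · obtain ⟨Υ₁, hΥ₁, h₁⟩ := (p.isClass D₁ hD₁ D hDc).1 hD
    exact ProjectivelyEquivOn.trans_projChange hU
      ⟨Υ₁, hΥ₁.mono (subset_univ U), fun x _ ↦ h₁ x (mem_univ x)⟩ hΥ

end FlatMetric

end ProjGeom

theorem corollary7p3 {M : Type*} [TopologicalSpace M] [T2Space M]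
    [ChartedSpace (EuclideanSpace ℝ (Fin 3)) M] [IsManifold (𝓡 3) ∞ M]
    (p : ProjGeom.ProjectiveStructure 3 M) (D : ProjGeom.ConnOp 3 M) (hD : D ∈ p.connections) :
    (p.HasEinsteinOn Set.univ → ProjGeom.WeylVanishes D) ∧
      (ProjGeom.WeylVanishes D ↔
        ∀ x : M, ∃ U : Set M, IsOpen U ∧ x ∈ U ∧ p.HasEinsteinOn U) := by
  refine ⟨fun h x ↦ ProjGeom.weyl_eq_zero_of_hasEinsteinOn hD isOpen_univ h (mem_univ x),
    fun h x ↦ ProjGeom.exists_hasEinsteinOn_of_weylVanishes le_rfl hD h x, fun h x ↦ ?_⟩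
  obtain ⟨U, hU, hxU, hE⟩ := h x
  exact ProjGeom.weyl_eq_zero_of_hasEinsteinOn hD hU hE hxU

end
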